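/- **Setting.** Let $\mathcal P$ and $\mathcal N$ be nonempty finite sets of positive and negative samples with real scores $s^+_x$ ($x\in\mathcal P$) and $s^-_y$ ($y\in\mathcal N$). A proper ranking is (the matrix of) a permutation of all the samples: $\mathbf R_{x,y}=1$ if $x$ is ranked higher than $y$, $-1$ if lower, and $0$ on the diagonal. The ground truth $\mathbf R^*$ has $\mathbf R^*_{x,y}=1=-\mathbf R^*_{y,x}$ for $x\in\mathcal P$, $y\in\mathcal N$ and zeros elsewhere. For $y\in\mathcal N$ let $ind^-(y)$ be the index of $y$ among the negative samples in $\mathbf R$ (counted from $1$), and let $rank(y)$ be one plus the number of positive samples ranked higher than $y$. *Loss-augmented inference* for a loss $\Delta$ is the problem of finding a proper ranking $\mathbf R$ that maximizes $$\Delta(\mathbf R^*,\mathbf R)+\frac1{|\mathcal P||\mathcal N|}\sum_{x\in\mathcal P}\sum_{y\in\mathcal N}\mathbf R_{x,y}\,(s^+_x-s^-_y).$$ The loss $\Delta$ (given for all sizes $|\mathcal P|,|\mathcal N|\ge1$) is *QS-suitable* if there are functions $\delta_j\colon\{1,\dots,|\mathcal P|+1\}\to\mathbb R$, $1\le j\le|\mathcal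 N|$ (depending on $|\mathcal P|,|\mathcal N|$), such that * (C1) $\Delta(\mathbf R^*,\mathbf R)=\sum_{y\in\mathcal N}\delta_{ind^-(y)}(rank(y))$ for every proper ranking $\mathbf R$; * (C2) $\delta_{j+1}(i+1)-\delta_{j+1}(i)\ge\delta_j(i+1)-\delta_j(i)$ for $1\le j<|\mathcal N|$, $1\le i\le|\mathcal P|$; * (C3) the values $\delta_j(i+1)-\delta_j(i)$, $1\le j\le|\mathcal N|$, $1\le i\le|\mathcal P|$, are computed from $|\mathcal P|,|\mathcal N|,j,i$ by a program without side effects on memory, in a number of steps bounded by a constant that is independent of $|\mathcal P|,|\mathcal N|,j,i$. Running times are measured on a real RAM: arithmetic operations on reals, addition, truncated subtraction and halving of integers, conversion of integers to reals, comparisons, register and array accesses and procedure calls cost one step each; the machine may in addition have any fixed countable stock of further unit-cost operations $\mathbb R^2\to\mathbb R$ (such as a logarithm). The input consists of $|\mathcal P|$, $|\mathcal N|$ and the two unsorted arrays of scores; the output is the list of the positions of all samples in a ranking. **Theorem.** If $\Delta$ is QS-suitable, then there is a program that, on all inputs with $|\mathcal P|,|\mathcal N|\ge1$, outputs an optimal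 solution of loss-augmented inference for $\Delta$ in time $$O\big(|\mathcal N|\log(1+|\mathcal P|)+|\mathcal P|\log(1+|\mathcal P|)+|\mathcal P|\log(1+|\mathcal N|)\big),$$ which is $O(|\mathcal N|\log(1+|\mathcal P|))$ on the inputs with $|\mathcal N|>|\mathcal P|$. In particular, on the inputs with $|\mathcal P|\ge2$ the time is $O(|\mathcal N|\log|\mathcal P|+|\mathcal P|\log|\mathcal P|+|\mathcal P|\log|\mathcal N|)$, and it is $O(|\mathcal N|\log|\mathcal P|)$ if moreover $|\mathcal N|>|\mathcal P|$. The constants depend on $\Delta$ (and the machine's stock of operations) only. -/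

import Mathlib

/-! ## A unit-cost real RAM with structured programs

The machine has integer and real registers (local to the procedure being executed) and integer and
real arrays (global memory). Programs are finite pieces of syntax; every arithmetic operation,
memory access, comparison, conversion of an integer to a real number, assignment, test and procedure
call costs one step. Integers can only be added, subtracted (truncated at `0`), halved and compared;
there is no conversion of real numbers into integers. In addition to the field operations and
comparison on reals, the machine may own further unit-cost real operations
`prim 0, prim 1, ... : ℝ → ℝ → ℝ` (for example a logarithm). -/

namespace RealRAM

/-- A machine state: local registers and global arrays. -/
structure State where
  natVar : ℕ → ℕ
  realVar : ℕ → ℝ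
  natArr : ℕ → ℕ → ℕ
  realArr : ℕ → ℕ → ℝ

/-- Integer expressions. -/
inductive NExp : Type
  | lit (k : ℕ)
  | var (x : ℕ)
  | get (a : ℕ) (i : NExp)
  | add (e₁ e₂ : NExp)
  | sub (e₁ e₂ : NExp)
  | half (e : NExp)

/-- Real expressions. -/
inductive RExp : Type
  | ofNat (e : NExp)
  | var (x : ℕ)
  | get (a : ℕ) (i : NExp)
  | add (e₁ e₂ : RExp)
  | sub (e₁ e₂ : RExp)
  | mul (e₁ e₂ : RExp)
  | div (e₁ e₂ : RExp)
  | prim (k : ℕ) (e₁ e₂ : RExp)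

/-- Tests. -/
inductive BExp : Type
  | nlt (e₁ e₂ : NExp)
  | rlt (e₁ e₂ : RExp)
  | not (b : BExp)
  | and (b₁ b₂ : BExp)

/-- Commands. `call f ns rs x y` runs the procedure number `f` in a fresh set of registers that
holds the values of the arguments `ns`, `rs` (and zeros), and copies the callee's integer register
`0` and real register `0` into the caller's registers `x` and `y`. -/
inductive Cmd : Type
  | skip
  | setNat (x : ℕ) (e : NExp)
  | setReal (x : ℕ) (e : RExp)
  | putNat (a : ℕ) (i : NExp) (e : NExp)
  | putReal (a : ℕ) (i : NExp) (e : RExp)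
  | seq (c d : Cmd)
  | cond (b : BExp) (c d : Cmd)
  | loop (b : BExp) (c : Cmd)
  | call (f : ℕ) (ns : List NExp) (rs : List RExp) (x y : ℕ)

def NExp.eval (s : State) : NExp → ℕ
  | .lit k => k
  | .var x => s.natVar x
  | .get a i => s.natArr a (i.eval s)
  | .add e₁ e₂ => e₁.eval s + e₂.eval s
  | .sub e₁ e₂ => e₁.eval s - e₂.eval s
  | .half e => e.eval s / 2

def NExp.cost : NExp → ℕ
  | .lit _ => 1
  | .var _ => 1
  | .get _ i => i.cost + 1
  | .add e₁ e₂ => e₁.cost + e₂.cost + 1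
  | .sub e₁ e₂ => e₁.cost + e₂.cost + 1
  | .half e => e.cost + 1

noncomputable def RExp.eval (prim : ℕ → ℝ → ℝ → ℝ) (s : State) : RExp → ℝ
  | .ofNat e => (e.eval s : ℝ)
  | .var x => s.realVar x
  | .get a i => s.realArr a (i.eval s)
  | .add e₁ e₂ => e₁.eval prim s + e₂.eval prim s
  | .sub e₁ e₂ => e₁.eval prim s - e₂.eval prim s
  | .mul e₁ e₂ => e₁.eval prim s * e₂.eval prim s
  | .div e₁ e₂ => e₁.eval prim s / e₂.eval prim s
  | .prim k e₁ e₂ => prim k (e₁.eval prim s) (e₂.eval prim s)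

def RExp.cost : RExp → ℕ
  | .ofNat e => e.cost + 1
  | .var _ => 1
  | .get _ i => i.cost + 1
  | .add e₁ e₂ => e₁.cost + e₂.cost + 1
  | .sub e₁ e₂ => e₁.cost + e₂.cost + 1
  | .mul e₁ e₂ => e₁.cost + e₂.cost + 1
  | .div e₁ e₂ => e₁.cost + e₂.cost + 1
  | .prim _ e₁ e₂ => e₁.cost + e₂.cost + 1

def BExp.eval (prim : ℕ → ℝ → ℝ → ℝ) (s : State) : BExp → Prop
  | .nlt e₁ e₂ => e₁.eval s < e₂.eval s
  | .rlt e₁ e₂ => e₁.eval prim s < e₂.eval prim s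
  | .not b => ¬ b.eval prim s
  | .and b₁ b₂ => b₁.eval prim s ∧ b₂.eval prim s

def BExp.cost : BExp → ℕ
  | .nlt e₁ e₂ => e₁.cost + e₂.cost + 1
  | .rlt e₁ e₂ => e₁.cost + e₂.cost + 1
  | .not b => b.cost + 1
  | .and b₁ b₂ => b₁.cost + b₂.cost + 1

/-- Assignment to an integer register. -/
def State.setNat (s : State) (x v : ℕ) : State :=
  { s with natVar := Function.update s.natVar x v }

/-- Assignment to a real register. -/
def State.setReal (s : State) (x : ℕ) (v : ℝ) : State :=
  { s with realVar := Function.update s.realVar x v }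

/-- Writing `v` into the cell `i` of the integer array `a`. -/
def State.putNat (s : State) (a i v : ℕ) : State :=
  { s with natArr := Function.update s.natArr a (Function.update (s.natArr a) i v) }

/-- Writing `v` into the cell `i` of the real array `a`. -/
def State.putReal (s : State) (a i : ℕ) (v : ℝ) : State :=
  { s with realArr := Function.update s.realArr a (Function.update (s.realArr a) i v) }

/-- The state in which a called procedure starts: its registers hold the arguments, followed by
zeros; the arrays are those of the caller. -/
def State.enter (s : State) (ns : List ℕ) (rs : List ℝ) : State where
  natVar k := ns.getD k 0
  realVar k := rs.getD k 0
  natArr := s.natArr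
  realArr := s.realArr

/-- The caller's state after a call that ended in the state `s'` of the callee. -/
def State.leave (s s' : State) (x y : ℕ) : State where
  natVar := Function.update s.natVar x (s'.natVar 0)
  realVar := Function.update s.realVar y (s'.realVar 0)
  natArr := s'.natArr
  realArr := s'.realArr

/-- `Exec prim procs c s t s'`: with the procedure table `procs`, the command `c` started in the
state `s` halts in the state `s'` after exactly `t` steps. -/
inductive Exec (prim : ℕ → ℝ → ℝ → ℝ) (procs : List Cmd) : Cmd → State → ℕ → State → Prop
  | skip (s : State) : Exec prim procs .skip s 1 s
  | setNat (s : State) (x : ℕ) (e : NExp) :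
      Exec prim procs (.setNat x e) s (e.cost + 1) (s.setNat x (e.eval s))
  | setReal (s : State) (x : ℕ) (e : RExp) :
      Exec prim procs (.setReal x e) s (e.cost + 1) (s.setReal x (e.eval prim s))
  | putNat (s : State) (a : ℕ) (i e : NExp) :
      Exec prim procs (.putNat a i e) s (i.cost + e.cost + 1) (s.putNat a (i.eval s) (e.eval s))
  | putReal (s : State) (a : ℕ) (i : NExp) (e : RExp) :
      Exec prim procs (.putReal a i e) s (i.cost + e.cost + 1)
        (s.putReal a (i.eval s) (e.eval prim s))
  | seq {c d : Cmd} {s s' s'' : State} {t t' : ℕ} :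
      Exec prim procs c s t s' → Exec prim procs d s' t' s'' →
      Exec prim procs (.seq c d) s (t + t') s''
  | condTrue {b : BExp} {c d : Cmd} {s s' : State} {t : ℕ} :
      b.eval prim s → Exec prim procs c s t s' →
      Exec prim procs (.cond b c d) s (b.cost + 1 + t) s'
  | condFalse {b : BExp} {c d : Cmd} {s s' : State} {t : ℕ} :
      ¬ b.eval prim s → Exec prim procs d s t s' →
      Exec prim procs (.cond b c d) s (b.cost + 1 + t) s'
  | loopDone {b : BExp} {c : Cmd} {s : State} :
      ¬ b.eval prim s → Exec prim procs (.loop b c) s (b.cost + 1) s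
  | loopStep {b : BExp} {c : Cmd} {s s' s'' : State} {t t' : ℕ} :
      b.eval prim s → Exec prim procs c s t s' → Exec prim procs (.loop b c) s' t' s'' →
      Exec prim procs (.loop b c) s (b.cost + 1 + t + t') s''
  | call {f : ℕ} {ns : List NExp} {rs : List RExp} {x y : ℕ} {c : Cmd} {s s' : State} {t : ℕ} :
      procs[f]? = some c →
      Exec prim procs c
        (s.enter (ns.map fun e => e.eval s) (rs.map fun e => e.eval prim s)) t s' →
      Exec prim procs (.call f ns rs x y) s
        ((ns.map NExp.cost).sum + (rs.map RExp.cost).sum + 1 + t) (s.leave s' x y)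

/-- A program: a finite table of (possibly recursive) procedures and a main command. -/
structure Program where
  procs : List Cmd
  main : Cmd

/-- The program `A` halts from `s` in `s'` after exactly `t` steps. -/
def Program.Runs (prim : ℕ → ℝ → ℝ → ℝ) (A : Program) (s : State) (t : ℕ) (s' : State) : Prop :=
  Exec prim A.procs A.main s t s'

end RealRAM

/-! ## Rankings, losses and loss-augmented inference -/

namespace Ranking

/-- The samples: `p` positive and `n` negative ones. -/
abbrev Sample (p n : ℕ) : Type := Fin p ⊕ Fin n

/-- Ranking matrices: the entry at `(x, y)` is `1` if `x` is ranked higher than `y`, `-1` if lower,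
`0` if they are ranked the same. -/
abbrev RankMatrix (p n : ℕ) : Type := Matrix (Sample p n) (Sample p n) ℤ

/-- The ground-truth ranking: all positive samples are ranked the same, and higher than all
negative samples, which are ranked the same. -/
def groundTruth (p n : ℕ) : RankMatrix p n
  | .inl _, .inr _ => 1
  | .inr _, .inl _ => -1
  | .inl _, .inl _ => 0
  | .inr _, .inr _ => 0

/-- The ranking matrix of a permutation of the samples; `π x` is the position of `x`, the position
`0` being the top. -/
def ofPositions {p n : ℕ} (π : Sample p n ≃ Fin (p + n)) : RankMatrix p n :=
  fun x y => if π x < π y then 1 else if π y < π x then -1 else 0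

/-- Proper rankings: those that come from a permutation of the samples. -/
def IsProper {p n : ℕ} (R : RankMatrix p n) : Prop :=
  ∃ π : Sample p n ≃ Fin (p + n), R = ofPositions π

/-- `ind⁻` of a negative sample: its index among the negative samples, counted from `1`. -/
def indNeg {p n : ℕ} (R : RankMatrix p n) (y : Fin n) : ℕ :=
  1 + (Finset.univ.filter fun y' : Fin n => R (.inr y') (.inr y) = 1).card

/-- The interleaving rank of a negative sample: one plus the number of positive samples that are
ranked higher. -/
def rankNeg {p n : ℕ} (R : RankMatrix p n) (y : Fin n) : ℕ :=
  1 + (Finset.univ.filter fun x : Fin p => R (.inl x) (.inr y) = 1).card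

/-- The score `F` of a ranking for the sample scores `sp` (positive) and `sn` (negative). -/
noncomputable def rankingScore {p n : ℕ} (sp : Fin p → ℝ) (sn : Fin n → ℝ) (R : RankMatrix p n) :
    ℝ :=
  1 / ((p : ℝ) * (n : ℝ)) * ∑ x : Fin p, ∑ y : Fin n, (R (.inl x) (.inr y) : ℝ) * (sp x - sn y)

/-- A loss function `Δ(R*, R)`, for all numbers of positive and negative samples. -/
abbrev Loss : Type := (p n : ℕ) → RankMatrix p n → RankMatrix p n → ℝ

/-- The objective of loss-augmented inference. -/
noncomputable def objective (Δ : Loss) {p n : ℕ} (sp : Fin p → ℝ) (sn : Fin n → ℝ)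
    (R : RankMatrix p n) : ℝ :=
  Δ p n (groundTruth p n) R + rankingScore sp sn R

/-- `R` solves the loss-augmented inference problem: it is a proper ranking that maximizes the
objective among all proper rankings. -/
def IsOptimal (Δ : Loss) {p n : ℕ} (sp : Fin p → ℝ) (sn : Fin n → ℝ) (R : RankMatrix p n) : Prop :=
  IsProper R ∧ ∀ R' : RankMatrix p n, IsProper R' → objective Δ sp sn R' ≤ objective Δ sp sn R

/-- Negative decomposability with interleaving dependence; `δ p n j i` stands for `δ_j(i)` in the
presence of `p` positive and `n` negative samples, and is used for `1 ≤ j ≤ n`,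
`1 ≤ i ≤ p + 1` only. -/
def NegDecomposable (Δ : Loss) (δ : ℕ → ℕ → ℕ → ℕ → ℝ) : Prop :=
  ∀ p n : ℕ, 1 ≤ p → 1 ≤ n → ∀ R : RankMatrix p n, IsProper R →
    Δ p n (groundTruth p n) R = ∑ y : Fin n, δ p n (indNeg R y) (rankNeg R y)

/-- `j`-monotonicity of the discrete derivative. -/
def MonotoneDerivative (δ : ℕ → ℕ → ℕ → ℕ → ℝ) : Prop :=
  ∀ p n : ℕ, 1 ≤ p → 1 ≤ n → ∀ j i : ℕ, 1 ≤ j → j < n → 1 ≤ i → i ≤ p →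
    δ p n j (i + 1) - δ p n j i ≤ δ p n (j + 1) (i + 1) - δ p n (j + 1) i

/-- Fast evaluation of the discrete derivative: some program, started in any memory with `p`, `n`,
`j`, `i` in its first integer registers and all other registers zero, leaves `δ_j(i+1) - δ_j(i)` in
its first real register within a constant number of steps, and does not change the memory. -/
def FastDerivative (prim : ℕ → ℝ → ℝ → ℝ) (δ : ℕ → ℕ → ℕ → ℕ → ℝ) : Prop :=
  ∃ (D : RealRAM.Program) (κ : ℕ), ∀ p n : ℕ, 1 ≤ p → 1 ≤ n →
    ∀ j i : ℕ, 1 ≤ j → j ≤ n → 1 ≤ i → i ≤ p → ∀ s : RealRAM.State,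
      ∃ (t : ℕ) (s' : RealRAM.State), D.Runs prim (s.enter [p, n, j, i] []) t s' ∧ t ≤ κ ∧
        s'.realVar 0 = δ p n j (i + 1) - δ p n j i ∧
        s'.natArr = s.natArr ∧ s'.realArr = s.realArr

/-- QS-suitable loss functions, over a real RAM with the additional operations `prim`. -/
def QSSuitable (prim : ℕ → ℝ → ℝ → ℝ) (Δ : Loss) : Prop :=
  ∃ δ : ℕ → ℕ → ℕ → ℕ → ℝ,
    NegDecomposable Δ δ ∧ MonotoneDerivative δ ∧ FastDerivative prim δ

/-- The input of loss-augmented inference: `p` and `n` in the first two integer registers, the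
(unsorted) scores of the positive and of the negative samples in the first two real arrays, and
zeros elsewhere. -/
def inputState {p n : ℕ} (sp : Fin p → ℝ) (sn : Fin n → ℝ) : RealRAM.State where
  natVar k := if k = 0 then p else if k = 1 then n else 0
  realVar _ := 0
  natArr _ _ := 0
  realArr a k :=
    if a = 0 then (if h : k < p then sp ⟨k, h⟩ else 0)
    else if a = 1 then (if h : k < n then sn ⟨k, h⟩ else 0)
    else 0

/-- The output convention: the first integer array lists the positions of the positive samples
and then those of the negative samples. -/
def Outputs {p n : ℕ} (s : RealRAM.State) (π : Sample p n ≃ Fin (p + n)) : Prop :=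
  (∀ x : Fin p, s.natArr 0 x = π (.inl x)) ∧ (∀ y : Fin n, s.natArr 0 (p + y) = π (.inr y))

/-- The program `A` solves loss-augmented inference within `T` steps: on every instance with `p ≥ 1`
positive and `n ≥ 1` negative samples, it halts after at most `T p n` steps and outputs an optimal
ranking. -/
def SolvesWithin (prim : ℕ → ℝ → ℝ → ℝ) (Δ : Loss) (A : RealRAM.Program) (T : ℕ → ℕ → ℝ) : Prop :=
  ∀ p n : ℕ, 1 ≤ p → 1 ≤ n → ∀ (sp : Fin p → ℝ) (sn : Fin n → ℝ),
    ∃ (t : ℕ) (s' : RealRAM.State) (π : Sample p n ≃ Fin (p + n)),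
      A.Runs prim (inputState sp sn) t s' ∧ (t : ℝ) ≤ T p n ∧
        Outputs s' π ∧ IsOptimal Δ sp sn (ofPositions π)

end Ranking

/-! Describe a ranking by the order of the negative samples and by the numbers `u_j` of positive
samples above the `j`-th negative one. An entry of the matrix between a positive and a negative
sample is twice the indicator of "positive above" minus one. Hence, up to a term that does not
depend on the ranking, the objective is the sum over `j` of `δ_j(u_j + 1)` plus `2/(pn)` times the
sum of the scores above `j` minus `u_j` times the score of `j`. Since `u_j` grows with `j`, the
rearrangement inequality bounds this by its value with both groups sorted by decreasing scores, that
is, by a sum of terms `G_j(u_j)`, and so by the sum of the separate maxima of the `G_j`.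

The increments `d_j(u) = G_j(u + 1) - G_j(u)` are nondecreasing in `j`, by (C2) and the order of the
negative scores. So maximizers `O_j` can be chosen nondecreasing in `j` (`IsBest.exists_le`,
`IsBest.exists_ge`), and then a single ranking realizes all of them (`exists_positions`). The bound
is attained, even if the negative samples are left unsorted among those with equal `O_j`
(`isOptimal_of_isBest`).

The algorithm sorts only the positive samples. For a segment of negative samples whose optima are
known to lie in `[a, b]`, it selects the median, scans `[a, b]` for its optimum `o`, and recurses
with `[a, o]` on the left and `[o, b]` on the right. When `a = b` everything is assigned at once, so
that the linear work on negative samples is repeated about `log p` and not `log n` times; the scans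
cost at most about `p` per level of recursion, with about `log n` levels (`interleaveBound_step`,
`run_interleave`). Worst-case linear selection comes from medians of medians (`run_select`); it also
supplies the pivots for sorting the positive samples (`run_quickSort`). -/

namespace RealRAM

/-! ### Weakest-precondition rules for the machine -/

variable {prim : ℕ → ℝ → ℝ → ℝ} {procs : List Cmd}

/-- The command `c` halts from `s`, and its running time and final state satisfy `Q`. -/
def Run (prim : ℕ → ℝ → ℝ → ℝ) (procs : List Cmd) (c : Cmd) (s : State)
    (Q : ℕ → State → Prop) : Prop :=
  ∃ t s', Exec prim procs c s t s' ∧ Q t s'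

theorem Run.mono {c : Cmd} {s : State} {Q Q' : ℕ → State → Prop} (h : Run prim procs c s Q)
    (hQ : ∀ t s', Q t s' → Q' t s') : Run prim procs c s Q' := by
  obtain ⟨t, s', he, hq⟩ := h
  exact ⟨t, s', he, hQ t s' hq⟩

@[simp] theorem run_skip (s : State) (Q : ℕ → State → Prop) :
    Run prim procs .skip s Q ↔ Q 1 s :=
  ⟨fun ⟨_, _, he, hq⟩ => by cases he; exact hq, fun h => ⟨_, _, .skip s, h⟩⟩

@[simp] theorem run_setNat (s : State) (x : ℕ) (e : NExp) (Q : ℕ → State → Prop) :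
    Run prim procs (.setNat x e) s Q ↔ Q (e.cost + 1) (s.setNat x (e.eval s)) :=
  ⟨fun ⟨_, _, he, hq⟩ => by cases he; exact hq, fun h => ⟨_, _, .setNat s x e, h⟩⟩

@[simp] theorem run_setReal (s : State) (x : ℕ) (e : RExp) (Q : ℕ → State → Prop) :
    Run prim procs (.setReal x e) s Q ↔ Q (e.cost + 1) (s.setReal x (e.eval prim s)) :=
  ⟨fun ⟨_, _, he, hq⟩ => by cases he; exact hq, fun h => ⟨_, _, .setReal s x e, h⟩⟩

@[simp] theorem run_putNat (s : State) (a : ℕ) (i e : NExp) (Q : ℕ → State → Prop) :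
    Run prim procs (.putNat a i e) s Q ↔
      Q (i.cost + e.cost + 1) (s.putNat a (i.eval s) (e.eval s)) :=
  ⟨fun ⟨_, _, he, hq⟩ => by cases he; exact hq, fun h => ⟨_, _, .putNat s a i e, h⟩⟩

@[simp] theorem run_putReal (s : State) (a : ℕ) (i : NExp) (e : RExp) (Q : ℕ → State → Prop) :
    Run prim procs (.putReal a i e) s Q ↔
      Q (i.cost + e.cost + 1) (s.putReal a (i.eval s) (e.eval prim s)) :=
  ⟨fun ⟨_, _, he, hq⟩ => by cases he; exact hq, fun h => ⟨_, _, .putReal s a i e, h⟩⟩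

@[simp] theorem run_seq (c d : Cmd) (s : State) (Q : ℕ → State → Prop) :
    Run prim procs (.seq c d) s Q ↔
      Run prim procs c s fun t s' => Run prim procs d s' fun t' s'' => Q (t + t') s'' := by
  constructor
  · rintro ⟨_, _, he, hq⟩
    cases he with
    | seq h₁ h₂ => exact ⟨_, _, h₁, _, _, h₂, hq⟩
  · rintro ⟨_, _, h₁, _, _, h₂, hq⟩
    exact ⟨_, _, .seq h₁ h₂, hq⟩

theorem run_cond {b : BExp} {c d : Cmd} {s : State} {Q : ℕ → State → Prop}
    (hc : b.eval prim s → Run prim procs c s fun t s' => Q (b.cost + 1 + t) s')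
    (hd : ¬ b.eval prim s → Run prim procs d s fun t s' => Q (b.cost + 1 + t) s') :
    Run prim procs (.cond b c d) s Q := by
  by_cases hb : b.eval prim s
  · obtain ⟨t, s', he, hq⟩ := hc hb
    exact ⟨_, _, .condTrue hb he, hq⟩
  · obtain ⟨t, s', he, hq⟩ := hd hb
    exact ⟨_, _, .condFalse hb he, hq⟩

theorem run_call {f : ℕ} {ns : List NExp} {rs : List RExp} {x y : ℕ} {c : Cmd} {s : State}
    {Q : ℕ → State → Prop} (hf : procs[f]? = some c)
    (h : Run prim procs c (s.enter (ns.map fun e => e.eval s) (rs.map fun e => e.eval prim s))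
      fun t s' => Q ((ns.map NExp.cost).sum + (rs.map RExp.cost).sum + 1 + t) (s.leave s' x y)) :
    Run prim procs (.call f ns rs x y) s Q := by
  obtain ⟨t, s', he, hq⟩ := h
  exact ⟨_, _, .call hf he, hq⟩

/-- A loop whose body takes at most `k` steps, preserves `I` and decreases `μ`. -/
theorem run_loop {b : BExp} {c : Cmd} (I : State → Prop) (μ : State → ℕ) (k : ℕ)
    (hstep : ∀ s, I s → b.eval prim s →
      Run prim procs c s fun t s' => t ≤ k ∧ μ s' < μ s ∧ I s')
    {s : State} (hs : I s) :
    Run prim procs (.loop b c) s fun t s' =>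
      t ≤ (b.cost + 1 + k) * μ s + (b.cost + 1) ∧ I s' ∧ ¬ b.eval prim s' := by
  induction hm : μ s using Nat.strong_induction_on generalizing s with
  | _ m ih =>
    by_cases hb : b.eval prim s
    · obtain ⟨t, s', he, ht, hμ, hI⟩ := hstep s hs hb
      obtain ⟨t', s'', he', ht', hI', hb'⟩ := ih (μ s') (hm ▸ hμ) hI rfl
      refine ⟨_, _, .loopStep hb he he', ?_, hI', hb'⟩
      have : (b.cost + 1 + k) * (μ s' + 1) ≤ (b.cost + 1 + k) * m :=
        Nat.mul_le_mul_left _ (by omega)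
      rw [mul_add, mul_one] at this
      omega
    · exact ⟨_, _, .loopDone hb, Nat.le_add_left _ _, hs, hb⟩

/-- Further procedures do not change the executions of a program. -/
theorem Exec.append {c : Cmd} {s s' : State} {t : ℕ} (h : Exec prim procs c s t s')
    (more : List Cmd) : Exec prim (procs ++ more) c s t s' := by
  induction h with
  | skip s => exact .skip s
  | setNat s x e => exact .setNat s x e
  | setReal s x e => exact .setReal s x e
  | putNat s a i e => exact .putNat s a i e
  | putReal s a i e => exact .putReal s a i e
  | seq _ _ h₁ h₂ => exact .seq h₁ h₂
  | condTrue hb _ h => exact .condTrue hb h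
  | condFalse hb _ h => exact .condFalse hb h
  | loopDone hb => exact .loopDone hb
  | loopStep hb _ _ h₁ h₂ => exact .loopStep hb h₁ h₂
  | call hf _ h =>
    refine .call ?_ h
    obtain ⟨hlt, -⟩ := List.getElem?_eq_some_iff.1 hf
    rw [List.getElem?_append_left hlt, hf]

section Simp

variable (s : State)

@[simp] theorem setNat_natVar (x v y : ℕ) :
    (s.setNat x v).natVar y = if y = x then v else s.natVar y := by
  simp [State.setNat, Function.update_apply]
@[simp] theorem setNat_realVar (x v : ℕ) : (s.setNat x v).realVar = s.realVar := rfl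
@[simp] theorem setNat_natArr (x v : ℕ) : (s.setNat x v).natArr = s.natArr := rfl
@[simp] theorem setNat_realArr (x v : ℕ) : (s.setNat x v).realArr = s.realArr := rfl
@[simp] theorem setReal_natVar (x : ℕ) (v : ℝ) : (s.setReal x v).natVar = s.natVar := rfl
@[simp] theorem setReal_realVar (x : ℕ) (v : ℝ) (y : ℕ) :
    (s.setReal x v).realVar y = if y = x then v else s.realVar y := by
  simp [State.setReal, Function.update_apply]
@[simp] theorem putNat_natVar (a i v : ℕ) : (s.putNat a i v).natVar = s.natVar := rfl
@[simp] theorem putNat_realArr (a i v : ℕ) : (s.putNat a i v).realArr = s.realArr := rfl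
@[simp] theorem putNat_natArr (a i v b : ℕ) :
    (s.putNat a i v).natArr b = if b = a then Function.update (s.natArr a) i v else s.natArr b := by
  simp [State.putNat, Function.update_apply]
@[simp] theorem putReal_natVar (a i : ℕ) (v : ℝ) : (s.putReal a i v).natVar = s.natVar := rfl
@[simp] theorem putReal_realArr (a i : ℕ) (v : ℝ) (b : ℕ) :
    (s.putReal a i v).realArr b =
      if b = a then Function.update (s.realArr a) i v else s.realArr b := by
  simp [State.putReal, Function.update_apply]
@[simp] theorem enter_natVar (ns : List ℕ) (rs : List ℝ) (k : ℕ) :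
    (s.enter ns rs).natVar k = ns.getD k 0 := rfl
@[simp] theorem leave_natVar (s' : State) (x y z : ℕ) :
    (s.leave s' x y).natVar z = if z = x then s'.natVar 0 else s.natVar z := by
  simp [State.leave, Function.update_apply]
@[simp] theorem leave_realVar (s' : State) (x y z : ℕ) :
    (s.leave s' x y).realVar z = if z = y then s'.realVar 0 else s.realVar z := by
  simp [State.leave, Function.update_apply]

end Simp

attribute [simp] NExp.eval NExp.cost RExp.eval RExp.cost BExp.eval BExp.cost

/-! ### Keys, permutations of segments, and counting -/

/-- The key of the slot `i` of the index array `1`; the keys are in the real array `2`. -/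
def State.key (s : State) (i : ℕ) : ℝ := s.realArr 2 (s.natArr 1 i)

/-- The expression for the key of a slot. -/
def keyAt (e : NExp) : RExp := .get 2 (.get 1 e)

@[simp] theorem keyAt_eval (e : NExp) (s : State) : (keyAt e).eval prim s = s.key (e.eval s) := rfl
@[simp] theorem keyAt_cost (e : NExp) : (keyAt e).cost = e.cost + 2 := rfl

@[simp] theorem key_setNat (s : State) (x v i : ℕ) : (s.setNat x v).key i = s.key i := rfl
@[simp] theorem key_setReal (s : State) (x : ℕ) (v : ℝ) (i : ℕ) :
    (s.setReal x v).key i = s.key i := rfl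
@[simp] theorem key_leave (s s' : State) (x y i : ℕ) : (s.leave s' x y).key i = s'.key i := rfl
@[simp] theorem key_putNat_two (s : State) (j v i : ℕ) : (s.putNat 2 j v).key i = s.key i := by
  simp [State.key]

/-- The memory of `s'` arises from that of `s` by permuting the index array within `[l, r)` and
changing the integer array `2` within `[l, r)`; the array `0` does not matter. -/
def Local (l r : ℕ) (s s' : State) : Prop :=
  s'.realArr = s.realArr ∧ (∀ i, (i < l ∨ r ≤ i) → s'.natArr 2 i = s.natArr 2 i) ∧
    ∃ σ : Equiv.Perm ℕ, (∀ i, (i < l ∨ r ≤ i) → σ i = i) ∧ s'.natArr 1 = s.natArr 1 ∘ σ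

theorem Local.of_eq {l r : ℕ} {s s' : State} (h₁ : s'.realArr = s.realArr)
    (h₂ : s'.natArr = s.natArr) : Local l r s s' :=
  ⟨h₁, fun _ _ => by rw [h₂], 1, fun _ _ => rfl, by rw [h₂]; rfl⟩

theorem Local.trans {l r : ℕ} {s s' s'' : State} (h : Local l r s s') (h' : Local l r s' s'') :
    Local l r s s'' := by
  obtain ⟨h₁, h₂, σ, hσ, h₃⟩ := h
  obtain ⟨h₁', h₂', τ, hτ, h₃'⟩ := h'
  refine ⟨h₁'.trans h₁, fun i hi => (h₂' i hi).trans (h₂ i hi), σ * τ, fun i hi => ?_, ?_⟩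
  · simp [hτ i hi, hσ i hi]
  · rw [h₃', h₃]; rfl

theorem Local.mono {l r l' r' : ℕ} {s s' : State} (h : Local l r s s') (hl : l' ≤ l)
    (hr : r ≤ r') : Local l' r' s s' := by
  obtain ⟨h₁, h₂, σ, hσ, h₃⟩ := h
  exact ⟨h₁, fun i hi => h₂ i (by omega), σ, fun i hi => hσ i (by omega), h₃⟩

/-- By injectivity, a permutation that fixes everything outside a segment cannot move a slot across
its boundary. -/
theorem perm_mem_segment {l r : ℕ} {σ : Equiv.Perm ℕ} (hσ : ∀ i, (i < l ∨ r ≤ i) → σ i = i)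
    {i : ℕ} : (l ≤ σ i ∧ σ i < r) ↔ (l ≤ i ∧ i < r) := by
  constructor
  · intro h
    by_contra hi
    rw [hσ i (by omega)] at h
    exact hi h
  · intro h
    by_contra hi
    have := σ.injective (hσ (σ i) (by omega))
    omega

theorem Local.exists_key {l r : ℕ} {s s' : State} (h : Local l r s s') :
    ∃ σ : Equiv.Perm ℕ, (∀ i, (i < l ∨ r ≤ i) → σ i = i) ∧ ∀ i, s'.key i = s.key (σ i) := by
  obtain ⟨h₁, -, σ, hσ, h₃⟩ := h
  exact ⟨σ, hσ, fun i => by simp [State.key, h₁, h₃]⟩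

theorem Local.key_outside {l r : ℕ} {s s' : State} (h : Local l r s s') {i : ℕ}
    (hi : i < l ∨ r ≤ i) : s'.key i = s.key i := by
  obtain ⟨σ, hσ, hk⟩ := h.exists_key
  rw [hk, hσ i hi]

theorem Local.key_forall {l r : ℕ} {s s' : State} (h : Local l r s s') {P : ℝ → Prop}
    (hP : ∀ i, l ≤ i → i < r → P (s.key i)) (i : ℕ) (hl : l ≤ i) (hr : i < r) :
    P (s'.key i) := by
  obtain ⟨σ, hσ, hk⟩ := h.exists_key
  rw [hk]
  have := (perm_mem_segment hσ (i := i)).2 ⟨hl, hr⟩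
  exact hP _ this.1 this.2

open Classical in
/-- The number of slots in `[l, r)` whose key satisfies `P`. -/
noncomputable def count (P : ℝ → Prop) (l r : ℕ) (s : State) : ℕ :=
  ((Finset.Ico l r).filter fun i => P (s.key i)).card

/-- Counts of keys stand in for the multiset of keys: they are what the rank arguments of selection
and of the median step carry through rearrangements. -/
theorem Local.count_eq {l r : ℕ} {s s' : State} (h : Local l r s s') (P : ℝ → Prop) :
    count P l r s' = count P l r s := by
  classical
  obtain ⟨σ, hσ, hk⟩ := h.exists_key
  unfold count
  refine Finset.card_bij (fun i _ => σ i) ?_ (fun _ _ _ _ h => σ.injective h) ?_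
  · intro i hi
    simp only [Finset.mem_filter, Finset.mem_Ico] at hi ⊢
    exact ⟨(perm_mem_segment hσ).2 hi.1, hk i ▸ hi.2⟩
  · intro i hi
    simp only [Finset.mem_filter, Finset.mem_Ico] at hi
    refine ⟨σ.symm i, ?_, by simp⟩
    simp only [Finset.mem_filter, Finset.mem_Ico]
    refine ⟨(perm_mem_segment hσ).1 (by simpa using hi.1), by rw [hk]; simpa using hi.2⟩

theorem count_split (P : ℝ → Prop) {l m r : ℕ} (hlm : l ≤ m) (hmr : m ≤ r) (s : State) :
    count P l r s = count P l m s + count P m r s := by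
  classical
  unfold count
  rw [← Finset.Ico_union_Ico_eq_Ico hlm hmr, Finset.filter_union,
    Finset.card_union_of_disjoint]
  exact Finset.disjoint_filter_filter (Finset.Ico_disjoint_Ico_consecutive l m r)

theorem count_le (P : ℝ → Prop) (l r : ℕ) (s : State) : count P l r s ≤ r - l := by
  classical
  exact (Finset.card_filter_le _ _).trans (by simp)

theorem count_eq_zero {P : ℝ → Prop} {l r : ℕ} {s : State}
    (h : ∀ i, l ≤ i → i < r → ¬ P (s.key i)) : count P l r s = 0 := by
  classical
  simp only [count, Finset.card_eq_zero, Finset.filter_eq_empty_iff, Finset.mem_Ico]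
  exact fun i hi => h i hi.1 hi.2

theorem count_eq_length {P : ℝ → Prop} {l r : ℕ} {s : State}
    (h : ∀ i, l ≤ i → i < r → P (s.key i)) : count P l r s = r - l := by
  classical
  rw [count, Finset.filter_true_of_mem fun i hi => ?_, Nat.card_Ico]
  exact h i (Finset.mem_Ico.1 hi).1 (Finset.mem_Ico.1 hi).2

theorem count_congr {P : ℝ → Prop} {l r : ℕ} {s s' : State}
    (h : ∀ i, l ≤ i → i < r → s'.key i = s.key i) : count P l r s' = count P l r s := by
  classical
  unfold count
  congr 1
  refine Finset.filter_congr fun i hi => ?_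
  rw [h i (Finset.mem_Ico.1 hi).1 (Finset.mem_Ico.1 hi).2]

/-- Exchanging the entries of the index array in the slots held by the registers `x` and `y`;
the register `9` is overwritten. -/
def swapCmd (x y : ℕ) : Cmd :=
  .seq (.setNat 9 (.get 1 (.var x)))
    (.seq (.putNat 1 (.var x) (.get 1 (.var y))) (.putNat 1 (.var y) (.var 9)))

/-- The effect of `swapCmd`. -/
def State.swap (s : State) (i j : ℕ) : State :=
  { s.setNat 9 (s.natArr 1 i) with
    natArr := Function.update s.natArr 1 (s.natArr 1 ∘ Equiv.swap i j) }

theorem run_swap {x y : ℕ} (hx : x ≠ 9) (hy : y ≠ 9) (s : State) (Q : ℕ → State → Prop)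
    (h : Q 10 (s.swap (s.natVar x) (s.natVar y))) : Run prim procs (swapCmd x y) s Q := by
  -- The three assignments amount to composing the index array with a transposition, also when the
  -- two slots coincide.
  have : ((s.setNat 9 (s.natArr 1 (s.natVar x))).putNat 1 (s.natVar x)
      (s.natArr 1 (s.natVar y))).putNat 1 (s.natVar y) (s.natArr 1 (s.natVar x)) =
      s.swap (s.natVar x) (s.natVar y) := by
    simp only [State.putNat, State.swap, State.setNat, Function.update_idem, Function.update_self]
    congr 2
    funext k
    simp only [Function.update_apply, Function.comp, Equiv.swap_apply_def]
    split_ifs <;> simp_all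
  simp only [swapCmd, run_seq, run_setNat, run_putNat]
  simp [hx, hy]
  rw [this]
  exact h

@[simp] theorem swap_natVar (s : State) (i j x : ℕ) :
    (s.swap i j).natVar x = if x = 9 then s.natArr 1 i else s.natVar x := setNat_natVar s _ _ _

@[simp] theorem swap_key (s : State) (i j k : ℕ) :
    (s.swap i j).key k = s.key (Equiv.swap i j k) := by
  simp [State.key, State.swap]

theorem local_swap {l r : ℕ} (s : State) {i j : ℕ} (hi : l ≤ i) (hi' : i < r) (hj : l ≤ j)
    (hj' : j < r) : Local l r s (s.swap i j) := by
  refine ⟨rfl, fun k _ => by simp [State.swap], Equiv.swap i j, fun k hk => ?_, by simp [State.swap]⟩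
  exact Equiv.swap_apply_of_ne_of_ne (by omega) (by omega)

end RealRAM

/-! ### Exchange sort and partitioning -/

namespace RealRAM

variable {prim : ℕ → ℝ → ℝ → ℝ} {procs : List Cmd}

/-- Exchange sort (decreasing keys) of the segment between the registers `0` and `1`. -/
def exchangeSort : Cmd :=
  .loop (.nlt (.var 0) (.var 1))
    (.seq (.setNat 2 (.add (.var 0) (.lit 1)))
      (.seq
        (.loop (.nlt (.var 2) (.var 1))
          (.seq (.cond (.rlt (keyAt (.var 0)) (keyAt (.var 2))) (swapCmd 0 2) .skip)
            (.setNat 2 (.add (.var 2) (.lit 1)))))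
        (.setNat 0 (.add (.var 0) (.lit 1)))))

/-- The program uses this only on boundedly many slots (groups of five and the base case of
selection), so a quadratic bound is harmless. It also serves, without being executed by the program,
as a proof that a sorted arrangement exists. -/
theorem run_exchangeSort (s : State) (l r : ℕ) (hl : s.natVar 0 = l) (hr : s.natVar 1 = r) :
    Run prim procs exchangeSort s fun t s' =>
      t ≤ 50 * (r - l + 1) * (r - l + 1) ∧ Local l r s s' ∧
        ∀ a b, l ≤ a → a ≤ b → b < r → s'.key b ≤ s'.key a := by
  refine (run_loop
    (fun u => u.natVar 1 = r ∧ l ≤ u.natVar 0 ∧ Local l r s u ∧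
      ∀ a b, l ≤ a → a < u.natVar 0 → a ≤ b → b < r → u.key b ≤ u.key a)
    (fun u => r - u.natVar 0) (27 * (r - l) + 20) ?_ ?_).mono ?_
  · rintro u ⟨h1, hlu, hloc, hsort⟩ hb
    simp only [BExp.eval, NExp.eval, h1] at hb
    simp only [run_seq, run_setNat]
    refine (run_loop
      (fun w => w.natVar 1 = r ∧ w.natVar 0 = u.natVar 0 ∧ u.natVar 0 < w.natVar 2 ∧
        w.natVar 2 ≤ r ∧ Local l r s w ∧
        (∀ a b, l ≤ a → a < u.natVar 0 → a ≤ b → b < r → w.key b ≤ w.key a) ∧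
        ∀ b, u.natVar 0 ≤ b → b < w.natVar 2 → w.key b ≤ w.key (u.natVar 0))
      (fun w => r - w.natVar 2) 23 ?_ ?_).mono ?_
    · rintro w ⟨w1, w0, hlt, hwr, wloc, wsort, wmax⟩ wb
      simp only [BExp.eval, NExp.eval, w1] at wb
      simp only [run_seq, run_setNat]
      refine run_cond (fun hc => ?_) (fun hc => ?_)
      · refine run_swap (by decide) (by decide) _ _ ?_
        simp only [BExp.eval, keyAt_eval, NExp.eval, w0] at hc
        simp [w0, w1]
        refine ⟨by omega, by omega, by omega,
          wloc.trans (Local.trans (local_swap w (by omega) (by omega) (by omega) wb)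
            (Local.of_eq rfl rfl)), ?_, ?_⟩
        · intro a b ha hau hab hbr
          -- The swap only touches slots from `u.natVar 0` on, so each slot of the finished prefix
          -- still dominates whatever arrives behind it.
          rw [Equiv.swap_apply_of_ne_of_ne (a := u.natVar 0) (x := a) (by omega) (by omega)]
          refine wsort a _ ha hau ?_ ?_ <;>
            (rw [Equiv.swap_apply_def]; split_ifs <;> omega)
        · intro b hub hbw
          rw [Equiv.swap_apply_def]
          split_ifs with h1 h2
          · exact le_rfl
          · exact hc.le
          · exact (wmax b hub (by omega)).trans hc.le
      · simp only [BExp.eval, keyAt_eval, NExp.eval, w0, not_lt] at hc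
        simp [w0, w1]
        refine ⟨by omega, by omega, by omega, wloc.trans (Local.of_eq rfl rfl), wsort, ?_⟩
        intro b hub hbw
        rcases (show b < w.natVar 2 ∨ b = w.natVar 2 by omega) with hb' | rfl
        · exact wmax b hub hb'
        · exact hc
    · simp [h1]
      refine ⟨hb, hloc.trans (Local.of_eq rfl rfl), hsort, ?_⟩
      intro b hb1 hb2
      rw [show b = u.natVar 0 by omega]
    · rintro t w ⟨ht, ⟨w1, w0, hlt, hwr, wloc, wsort, wmax⟩, wb⟩
      simp only [BExp.eval, NExp.eval, w1, not_lt] at wb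
      simp [w0, w1] at ht ⊢
      refine ⟨by omega, by omega, by omega, wloc.trans (Local.of_eq rfl rfl), ?_⟩
      intro a b ha hau hab hbr
      rcases (show a < u.natVar 0 ∨ a = u.natVar 0 by omega) with h | rfl
      · exact wsort a b ha h hab hbr
      · exact wmax b hab (by omega)
  · exact ⟨hr, hl.ge, Local.of_eq rfl rfl, fun a b ha ha' => by omega⟩
  · rintro t u ⟨ht, ⟨h1, hlu, hloc, hsort⟩, hb⟩
    simp only [BExp.eval, NExp.eval, h1, not_lt] at hb
    simp [hl] at ht
    refine ⟨ht.trans (by nlinarith), hloc, fun a b ha hab hbr => hsort a b ha (by omega) hab hbr⟩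

/-- Moving the slots of the segment from register `5` to register `1` that pass the test `b`, which
is about the slot in register `5`, to the front; register `6` ends behind them. -/
def partitionLoop (b : BExp) : Cmd :=
  .loop (.nlt (.var 5) (.var 1))
    (.seq (.cond b (.seq (swapCmd 6 5) (.setNat 6 (.add (.var 6) (.lit 1)))) .skip)
      (.setNat 5 (.add (.var 5) (.lit 1))))

/-- The invariant is that `[l, reg 6)` passes the test and `[reg 6, reg 5)` fails it. The real
registers never change, so the test need only agree with `P` while real register `0`, which holds
the pivot, keeps its value. -/
theorem run_partitionLoop (b : BExp) (P : ℝ → Prop) (s : State) (l r : ℕ)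
    (hb : ∀ u : State, u.realVar 0 = s.realVar 0 →
      (b.eval prim u ↔ P (u.key (u.natVar 5))))
    (h5 : s.natVar 5 = l) (h6 : s.natVar 6 = l) (h1 : s.natVar 1 = r) (hlr : l ≤ r) :
    Run prim procs (partitionLoop b) s fun t s' =>
      t ≤ (b.cost + 30) * (r - l) + 4 ∧ Local l r s s' ∧ s'.realVar = s.realVar ∧
        (∀ x, x < 5 → s'.natVar x = s.natVar x) ∧ l ≤ s'.natVar 6 ∧ s'.natVar 6 ≤ r ∧
        (∀ i, l ≤ i → i < s'.natVar 6 → P (s'.key i)) ∧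
        ∀ i, s'.natVar 6 ≤ i → i < r → ¬ P (s'.key i) := by
  refine (run_loop
    (fun u => Local l r s u ∧ u.realVar = s.realVar ∧
      (∀ x, x < 5 → u.natVar x = s.natVar x) ∧ l ≤ u.natVar 6 ∧ u.natVar 6 ≤ u.natVar 5 ∧
        u.natVar 5 ≤ r ∧
        (∀ i, l ≤ i → i < u.natVar 6 → P (u.key i)) ∧
        ∀ i, u.natVar 6 ≤ i → i < u.natVar 5 → ¬ P (u.key i))
    (fun u => r - u.natVar 5) (b.cost + 20) ?_ ?_).mono ?_
  · rintro u ⟨hloc, hre, hreg, hl6, h65, h5r, hP, hnP⟩ hlt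
    simp only [BExp.eval, NExp.eval, hreg 1 (by decide), h1] at hlt
    have hbu := hb u (by rw [hre])
    simp only [run_seq, run_setNat]
    refine run_cond (fun hc => ?_) (fun hc => ?_)
    · simp only [run_seq]
      refine run_swap (by decide) (by decide) _ _ ?_
      simp
      refine ⟨by omega, hloc.trans ((local_swap u (by omega) (by omega) (by omega) hlt).trans
        (Local.of_eq rfl rfl)), hre, ?_, by omega, by omega, by omega, ?_, ?_⟩
      · intro x hx
        rw [if_neg (by omega), if_neg (by omega), if_neg (by omega)]
        exact hreg x hx
      · intro i hi1 hi2
        rw [Equiv.swap_apply_def]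
        split_ifs with e1 e2
        · exact hbu.1 hc
        · subst e2
          rw [show u.natVar 6 = u.natVar 5 by omega]
          exact hbu.1 hc
        · exact hP i hi1 (by omega)
      · intro i hi1 hi2
        rw [Equiv.swap_apply_def]
        split_ifs with e1 e2
        · omega
        · exact hnP _ le_rfl (by omega)
        · exact hnP i (by omega) (by omega)
    · simp
      refine ⟨by omega, hloc.trans (Local.of_eq rfl rfl), hre, ?_, hl6, by omega,
        by omega, hP, ?_⟩
      · intro x hx
        rw [if_neg (by omega)]
        exact hreg x hx
      · intro i hi1 hi2
        rcases (show i < u.natVar 5 ∨ i = u.natVar 5 by omega) with h | rfl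
        · exact hnP i hi1 h
        · exact fun h => hc (hbu.2 h)
  · exact ⟨Local.of_eq rfl rfl, rfl, fun _ _ => rfl, h6.ge, by rw [h5, h6], by omega,
      fun i hi1 hi2 => by omega, fun i hi1 hi2 => by omega⟩
  · rintro t u ⟨ht, ⟨hloc, hre, hreg, hl6, h65, h5r, hP, hnP⟩, hlt⟩
    simp only [BExp.eval, NExp.eval, hreg 1 (by decide), h1, not_lt] at hlt
    simp [h5] at ht
    refine ⟨ht.trans ?_, hloc, hre, hreg, hl6, by omega, hP, fun i hi1 hi2 => hnP i hi1 (by omega)⟩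
    have : 4 + (b.cost + 20) ≤ b.cost + 30 := by omega
    gcongr

end RealRAM

/-! ### Linear-time selection by medians of medians -/

namespace RealRAM

variable {prim : ℕ → ℝ → ℝ → ℝ} {procs : List Cmd}


/-- One more group adds at most one slot to the front, namely its median, and if that median
satisfies `P` then the group adds at least three slots to the total. The swap stays inside `[l, i +
5)` and outside `[l, m)`, so it disturbs neither the total nor the old front. -/
theorem count_group_step {P : ℝ → Prop} {u w : State} {l m i : ℕ} (hlm : l ≤ m) (hmi : m ≤ i)
    (hloc : Local i (i + 5) u w) (hP : P (w.key (i + 2)) → 3 ≤ count P i (i + 5) w)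
    (h : 3 * count P l m u ≤ count P l i u) :
    3 * count P l (m + 1) (w.swap m (i + 2)) ≤ count P l (i + 5) (w.swap m (i + 2)) := by
  have hsw : Local l (i + 5) w (w.swap m (i + 2)) :=
    local_swap w hlm (by omega) (by omega) (by omega)
  rw [hsw.count_eq P, count_split P (hlm.trans hmi) (by omega : i ≤ i + 5),
    count_split P hlm (by omega : m ≤ m + 1)]
  have e1 : count P l i w = count P l i u :=
    count_congr fun j _ hj => hloc.key_outside (by omega)
  have e2 : count P l m (w.swap m (i + 2)) = count P l m u := by
    refine count_congr fun j _ hj => ?_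
    rw [swap_key, Equiv.swap_apply_of_ne_of_ne (by omega) (by omega),
      hloc.key_outside (by omega)]
  have e3 := count_le P m (m + 1) (w.swap m (i + 2))
  rw [e1, e2]
  by_cases hk : P (w.key (i + 2))
  · have := hP hk
    omega
  · have : count P m (m + 1) (w.swap m (i + 2)) = 0 := by
      refine count_eq_zero fun j h1 h2 => ?_
      obtain rfl : j = m := by omega
      simpa using hk
    omega

theorem three_le_count_of_ge {w : State} {i : ℕ} {v : ℝ}
    (hs : ∀ a b, i ≤ a → a ≤ b → b < i + 5 → w.key b ≤ w.key a) (h : v ≤ w.key (i + 2)) :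
    3 ≤ count (fun x => v ≤ x) i (i + 5) w := by
  rw [count_split _ (by omega : i ≤ i + 3) (by omega), count_eq_length]
  · omega
  · exact fun j h1 h2 => h.trans (hs j (i + 2) h1 (by omega) (by omega))

theorem three_le_count_of_le {w : State} {i : ℕ} {v : ℝ}
    (hs : ∀ a b, i ≤ a → a ≤ b → b < i + 5 → w.key b ≤ w.key a) (h : w.key (i + 2) ≤ v) :
    3 ≤ count (fun x => x ≤ v) i (i + 5) w := by
  rw [count_split _ (by omega : i ≤ i + 2) (by omega),
    count_eq_length (l := i + 2) fun j h1 h2 => (hs (i + 2) j (by omega) h1 h2).trans h]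
  omega

/-- Moving the medians of the groups of five slots of the segment between the registers `0` and `1`
to its front; register `4` ends behind them. -/
def medianLoop (B : ℕ) : Cmd :=
  .loop (.not (.nlt (.var 1) (.add (.var 3) (.lit 5))))
    -- A call always returns two values; the integer register `8` and the real register `1` merely
    -- receive results that are discarded.
    (.seq (.call (B + 1) [.var 3, .add (.var 3) (.lit 5)] [] 8 1)
      (.seq (.setNat 5 (.add (.var 3) (.lit 2)))
        (.seq (swapCmd 4 5)
          (.seq (.setNat 4 (.add (.var 4) (.lit 1))) (.setNat 3 (.add (.var 3) (.lit 5)))))))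

/-- At most four slots at the end belong to no group. The two count inequalities hold for all
thresholds `v`, because the pivot is only determined later, by the recursive selection among the
medians. -/
theorem run_medianLoop {B : ℕ} (hB : procs[B + 1]? = some exchangeSort) (s : State) (l r : ℕ)
    (h1 : s.natVar 1 = r) (h3 : s.natVar 3 = l) (h4 : s.natVar 4 = l) (hlr : l ≤ r) :
    Run prim procs (medianLoop B) s fun t s' =>
      t ≤ 2000 * (r - l) + 10 ∧ Local l r s s' ∧ (∀ x, x < 3 → s'.natVar x = s.natVar x) ∧
        l ≤ s'.natVar 4 ∧ 5 * (s'.natVar 4 - l) ≤ r - l ∧ r - l < 5 * (s'.natVar 4 - l) + 5 ∧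
        ∀ v, 3 * count (fun x => v ≤ x) l (s'.natVar 4) s' ≤ count (fun x => v ≤ x) l r s' ∧
          3 * count (fun x => x ≤ v) l (s'.natVar 4) s' ≤ count (fun x => x ≤ v) l r s' := by
  refine (run_loop
    (fun u => Local l r s u ∧ (∀ x, x < 3 → u.natVar x = s.natVar x) ∧ l ≤ u.natVar 4 ∧
      -- This says that the slots consumed are five times the medians collected, written without
      -- truncated subtraction.
      u.natVar 3 + 4 * l = 5 * u.natVar 4 ∧ u.natVar 3 ≤ r ∧
      (∀ v, 3 * count (fun x => v ≤ x) l (u.natVar 4) u ≤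
        count (fun x => v ≤ x) l (u.natVar 3) u) ∧
      ∀ v, 3 * count (fun x => x ≤ v) l (u.natVar 4) u ≤
        count (fun x => x ≤ v) l (u.natVar 3) u)
    (fun u => r - u.natVar 3) 1900 ?_ ?_).mono ?_
  · rintro u ⟨hloc, hreg, hl4, h34, h3r, hge, hle⟩ hb
    simp only [BExp.eval, NExp.eval, hreg 1 (by decide), h1, not_lt] at hb
    simp only [run_seq, run_setNat]
    refine run_call hB ((run_exchangeSort _ (u.natVar 3) (u.natVar 3 + 5) ?_ ?_).mono ?_)
    · simp
    · simp
    rintro t w ⟨ht, wloc, wsort⟩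
    rw [Nat.add_sub_cancel_left] at ht
    refine run_swap (by decide) (by decide) _ _ ?_
    simp
    have wloc' : Local (u.natVar 3) (u.natVar 3 + 5) u ((u.leave w 8 1).setNat 5 (u.natVar 3 + 2)) :=
      ((Local.of_eq rfl rfl).trans wloc).trans (Local.of_eq rfl rfl)
    refine ⟨by omega, by omega, ?_, ?_, by omega, by omega, by omega, fun v => ?_, fun v => ?_⟩
    · exact hloc.trans ((wloc'.mono (by omega) hb).trans
        ((local_swap _ (by omega) (by omega) (by omega) (by omega)).trans (Local.of_eq rfl rfl)))
    · intro x hx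
      rw [if_neg (by omega), if_neg (by omega), if_neg (by omega), if_neg (by omega),
        if_neg (by omega)]
      exact hreg x hx
    · exact count_group_step hl4 (by omega) wloc' (three_le_count_of_ge wsort) (hge v)
    · exact count_group_step hl4 (by omega) wloc' (three_le_count_of_le wsort) (hle v)
  · refine ⟨Local.of_eq rfl rfl, fun _ _ => rfl, h4.ge, by omega, by omega, fun v => ?_, fun v => ?_⟩
    all_goals
      rw [h3, h4, count_eq_zero (fun j _ _ => by omega)]
  · rintro t u ⟨ht, ⟨hloc, hreg, hl4, h34, h3r, hge, hle⟩, hb⟩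
    simp only [BExp.eval, NExp.eval, hreg 1 (by decide), h1, not_not] at hb
    simp [h3] at ht
    refine ⟨by omega, hloc, hreg, hl4, by omega, by omega, fun v => ⟨?_, ?_⟩⟩
    · rw [count_split _ (by omega : l ≤ u.natVar 3) h3r]
      exact (hge v).trans (Nat.le_add_right _ _)
    · rw [count_split _ (by omega : l ≤ u.natVar 3) h3r]
      exact (hle v).trans (Nat.le_add_right _ _)

/-- Selection by medians of medians: the arguments are the ends `l`, `r` of a segment and a slot `k`
of it; the segment is permuted so that the keys before `k` are at least, and those behind `k` are at
most the key in `k`. -/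
def select (B : ℕ) : Cmd :=
  .cond (.nlt (.var 1) (.add (.var 0) (.lit 24)))
    (.call (B + 1) [.var 0, .var 1] [] 8 1)
    (.seq (.setNat 3 (.var 0)) (.seq (.setNat 4 (.var 0)) (.seq (medianLoop B)
      (.seq (.setNat 7 (.add (.var 0) (.half (.sub (.var 4) (.var 0)))))
      (.seq (.call (B + 2) [.var 0, .var 4, .var 7] [] 8 1)
      (.seq (.setReal 0 (keyAt (.var 7)))
      (.seq (.setNat 5 (.var 0)) (.seq (.setNat 6 (.var 0))
      (.seq (partitionLoop (.rlt (.var 0) (keyAt (.var 5))))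
      (.seq (.setNat 3 (.var 6)) (.seq (.setNat 5 (.var 6))
      (.seq (partitionLoop (.not (.rlt (keyAt (.var 5)) (.var 0))))
      (.cond (.nlt (.var 2) (.var 3))
        (.call (B + 2) [.var 0, .var 3, .var 2] [] 8 1)
        (.cond (.nlt (.var 2) (.var 6)) .skip
          (.call (B + 2) [.var 6, .var 1, .var 2] [] 8 1)))))))))))))))

/-- With `M` medians among `N` slots, at least `3M/2` keys are at least the pivot and at least
`3M/2` are at most the pivot. So either strict side has at most `N - 3M/2` slots, and the two
recursive calls together handle at most `N - M/2` slots. As `M` is about `N/5`, the saving of about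
`N/10` pays for the linear work. Keys equal to the pivot form a middle block that needs no
recursion. -/
theorem run_select {B : ℕ} (hB1 : procs[B + 1]? = some exchangeSort)
    (hB2 : procs[B + 2]? = some (select B)) (s : State) (l r k : ℕ) (h0 : s.natVar 0 = l)
    (h1 : s.natVar 1 = r) (h2 : s.natVar 2 = k) (hlk : l ≤ k) (hkr : k < r) :
    Run prim procs (select B) s fun t s' =>
      t ≤ 50000 * (r - l) ∧ Local l r s s' ∧ (∀ i, l ≤ i → i < k → s'.key k ≤ s'.key i) ∧
        ∀ i, k < i → i < r → s'.key i ≤ s'.key k := by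
  induction hn : r - l using Nat.strong_induction_on generalizing s l r k with
  | _ n ih =>
    subst hn
    refine run_cond (fun hc => ?_) (fun hc => ?_)
    · simp only [BExp.eval, NExp.eval, h0, h1] at hc
      refine run_call hB1 ((run_exchangeSort _ l r (by simpa) (by simpa)).mono ?_)
      rintro t w ⟨ht, wloc, wsort⟩
      -- The base case has fewer than `24` slots, and its constant cost is covered because the
      -- segment is nonempty.
      have : 50 * (r - l + 1) * (r - l + 1) ≤ 50 * 24 * 24 := by gcongr <;> omega
      refine ⟨?_, ((Local.of_eq rfl rfl).trans wloc).trans (Local.of_eq rfl rfl),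
        fun i hi hik => wsort i k hi hik.le hkr, fun i hki hir => wsort k i hlk hki.le hir⟩
      simp
      omega
    simp only [BExp.eval, NExp.eval, h0, h1, not_lt] at hc
    simp only [run_seq, run_setNat, run_setReal]
    refine (run_medianLoop hB1 _ l r ?_ ?_ ?_ (by omega)).mono ?_
    · simp [h1]
    · simp [h0]
    · simp [h0]
    rintro t1 s1 ⟨ht1, loc1, reg1, hlm, hm1, hm2, hcount⟩
    have r0 : s1.natVar 0 = l := by rw [reg1 0 (by decide)]; simp [h0]
    have r1 : s1.natVar 1 = r := by rw [reg1 1 (by decide)]; simp [h1]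
    have r2 : s1.natVar 2 = k := by rw [reg1 2 (by decide)]; simp [h2]
    replace loc1 : Local l r s s1 := (Local.of_eq rfl rfl).trans loc1
    generalize hm : s1.natVar 4 = m at *
    have hlen : (m - l) / 2 < m - l := by omega
    refine run_call hB2 ((ih (m - l) (by omega) _ l m (l + (m - l) / 2) ?_ ?_ ?_ (by omega)
      (by omega) rfl).mono ?_)
    · simp [r0]
    · simp [hm]
    · simp [r0, hm]
    rintro t2 s2 ⟨ht2, loc2, hleft, hright⟩
    replace loc2 : Local l m s1 s2 := (Local.of_eq rfl rfl).trans loc2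
    -- The medians up to the selected one have keys at least the pivot, and each of them accounts
    -- for three slots of the segment; `cnt2` is the mirror image.
    have cnt1 : 3 * ((m - l) / 2 + 1) ≤ count (fun x => s2.key (l + (m - l) / 2) ≤ x) l r s2 := by
      rw [(loc2.mono le_rfl (by omega)).count_eq]
      refine le_trans ?_ (hcount _).1
      rw [← loc2.count_eq, count_split _ (by omega : l ≤ l + (m - l) / 2 + 1) (by omega),
        count_eq_length]
      · omega
      · intro i hi1 hi2
        rcases (show i < l + (m - l) / 2 ∨ i = l + (m - l) / 2 by omega) with h | rfl
        · exact hleft i hi1 h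
        · exact le_rfl
    have cnt2 : 3 * (m - l - (m - l) / 2) ≤
        count (fun x => x ≤ s2.key (l + (m - l) / 2)) l r s2 := by
      rw [(loc2.mono le_rfl (by omega)).count_eq]
      refine le_trans ?_ (hcount _).2
      rw [← loc2.count_eq, count_split _ (by omega : l ≤ l + (m - l) / 2) (by omega),
        count_eq_length (l := l + (m - l) / 2)]
      · omega
      · intro i hi1 hi2
        rcases (show l + (m - l) / 2 < i ∨ i = l + (m - l) / 2 by omega) with h | rfl
        · exact hright i h hi2
        · exact le_rfl
    generalize hpv : s2.key (l + (m - l) / 2) = pv at *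
    refine (run_partitionLoop _ (fun x => pv < x) _ l r ?_ ?_ ?_ ?_ (by omega)).mono ?_
    · intro u hu
      simp [hu, r0, hm, hpv]
    · simp [r0]
    · simp [r0]
    · simp [r1]
    rintro t3 s3 ⟨ht3, loc3, real3, reg3, hq1, hq1', hgt, hngt⟩
    have r0' : s3.natVar 0 = l := by rw [reg3 0 (by decide)]; simp [r0]
    have r1' : s3.natVar 1 = r := by rw [reg3 1 (by decide)]; simp [r1]
    have r2' : s3.natVar 2 = k := by rw [reg3 2 (by decide)]; simp [r2]
    have real3' : s3.realVar 0 = pv := by rw [real3]; simp [r0, hm, hpv]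
    replace loc3 : Local l r s2 s3 := (Local.of_eq rfl rfl).trans loc3
    generalize hq : s3.natVar 6 = q at *
    refine (run_partitionLoop _ (fun x => pv ≤ x) _ q r ?_ ?_ ?_ ?_ (by omega)).mono ?_
    · intro u hu
      simp [hu, real3']
    · simp [hq]
    · simp [hq]
    · simp [r1']
    rintro t4 s4 ⟨ht4, loc4, real4, reg4, hq2, hq2', hge, hnge⟩
    have r0'' : s4.natVar 0 = l := by rw [reg4 0 (by decide)]; simp [r0']
    have r1'' : s4.natVar 1 = r := by rw [reg4 1 (by decide)]; simp [r1']
    have r2'' : s4.natVar 2 = k := by rw [reg4 2 (by decide)]; simp [r2']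
    have r3'' : s4.natVar 3 = q := by rw [reg4 3 (by decide)]; simp [hq]
    replace loc4 : Local q r s3 s4 := (Local.of_eq rfl rfl).trans loc4
    generalize hq' : s4.natVar 6 = q' at *
    have loc24 : Local l r s2 s4 := loc3.trans (loc4.mono hq1 le_rfl)
    have loc : Local l r s s4 := loc1.trans ((loc2.mono le_rfl (by omega)).trans loc24)
    -- The partitions only permute the segment, so the counts persist and now bound the lengths of
    -- the blocks: `[l, q)` is above the pivot, `[q, q')` equals it, and `[q', r)` is below.
    rw [← loc24.count_eq] at cnt1 cnt2
    replace hgt : ∀ i, l ≤ i → i < q → pv < s4.key i := fun i hi1 hi2 => by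
      rw [loc4.key_outside (by omega)]
      exact hgt i hi1 hi2
    replace hngt : ∀ i, q ≤ i → i < r → s4.key i ≤ pv :=
      loc4.key_forall (P := fun x => x ≤ pv) fun i hi1 hi2 => not_lt.1 (hngt i hi1 hi2)
    replace hnge : ∀ i, q' ≤ i → i < r → s4.key i < pv := fun i hi1 hi2 => not_le.1 (hnge i hi1 hi2)
    rw [count_split _ (by omega : l ≤ q') hq2', count_eq_zero (l := q')
      fun i hi1 hi2 => not_le.2 (hnge i hi1 hi2)] at cnt1
    rw [count_split _ hq1 hq1', count_eq_zero (P := fun x => x ≤ pv) (l := l)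
      fun i hi1 hi2 => not_le.2 (hgt i hi1 hi2)] at cnt2
    have c1 := cnt1.trans (Nat.add_le_add_right (count_le _ _ _ _) 0)
    have c2 := cnt2.trans (Nat.add_le_add_left (count_le _ _ _ _) 0)
    simp at ht3 ht4
    have hx : 3 * (m - l) + 2 * (q - l) ≤ 2 * (r - l) := by clear * - c2 hlm hq1 hq1'; omega
    have hx' : 3 * (m - l) + 2 * (r - q') ≤ 2 * (r - l) := by
      clear * - c1 hlm hq1 hq2 hq2'; omega
    have hqr : r - q ≤ r - l := by clear * - hq1; omega
    -- Here `t2` is at most `50000 * (m - l)`, while `hx` saves `75000 * (m - l)`; the difference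
    -- exceeds the linear cost of the medians and partitions once there are at least `24` slots.
    have hq_time : t1 + t2 + t3 + t4 + 50000 * (q - l) + 60 ≤ 50000 * (r - l) := by
      clear * - ht1 ht2 ht3 ht4 hx hm1 hm2 hc hqr; omega
    have hq_time' : t1 + t2 + t3 + t4 + 50000 * (r - q') + 60 ≤ 50000 * (r - l) := by
      clear * - ht1 ht2 ht3 ht4 hx' hm1 hm2 hc hqr; omega
    refine run_cond (fun hkq => ?_) (fun hkq => ?_)
    · simp only [BExp.eval, NExp.eval, r2'', r3''] at hkq
      refine run_call hB2 ((ih (q - l) (by omega) _ l q k ?_ ?_ ?_ hlk hkq rfl).mono ?_)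
      · simp [r0'']
      · simp [r3'']
      · simp [r2'']
      rintro t5 s5 ⟨ht5, loc5, hleft', hright'⟩
      replace loc5 : Local l q s4 s5 := (Local.of_eq rfl rfl).trans loc5
      refine ⟨?_, loc.trans ((loc5.mono le_rfl hq1').trans (Local.of_eq rfl rfl)), hleft', ?_⟩
      · simp
        clear * - hq_time ht5; omega
      · intro i hki hir
        rcases lt_or_ge i q with h | h
        · exact hright' i hki h
        · have a1 : s5.key i ≤ pv := by
            rw [loc5.key_outside (by omega)]
            exact hngt i h hir
          exact a1.trans (loc5.key_forall (P := fun x => pv < x) hgt k hlk hkq).le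
    · simp only [BExp.eval, NExp.eval, r2'', r3'', not_lt] at hkq
      refine run_cond (fun hkq' => ?_) (fun hkq' => ?_)
      · simp only [BExp.eval, NExp.eval, r2'', hq'] at hkq'
        rw [run_skip]
        have ek : s4.key k = pv := le_antisymm (hngt k hkq hkr) (hge k hkq hkq')
        refine ⟨?_, loc, fun i hi1 hi2 => ?_, fun i hi1 hi2 => ?_⟩
        · simp
          clear * - hq_time; omega
        · rw [ek]
          rcases lt_or_ge i q with h | h
          · exact (hgt i hi1 h).le
          · exact hge i h (by omega)
        · rw [ek]
          exact hngt i (by omega) hi2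
      · simp only [BExp.eval, NExp.eval, r2'', hq', not_lt] at hkq'
        refine run_call hB2 ((ih (r - q') (by omega) _ q' r k ?_ ?_ ?_ hkq' hkr rfl).mono ?_)
        · simp [hq']
        · simp [r1'']
        · simp [r2'']
        rintro t5 s5 ⟨ht5, loc5, hleft', hright'⟩
        replace loc5 : Local q' r s4 s5 := (Local.of_eq rfl rfl).trans loc5
        refine ⟨?_, loc.trans ((loc5.mono (by omega) le_rfl).trans (Local.of_eq rfl rfl)), ?_,
          hright'⟩
        · simp
          clear * - hq_time' ht5; omega
        · intro i hi1 hi2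
          rcases lt_or_ge i q' with h | h
          · have a1 : s5.key k < pv := loc5.key_forall (P := fun x => x < pv) hnge k hkq' hkr
            refine a1.le.trans ?_
            change pv ≤ s5.key i
            rw [loc5.key_outside (by omega)]
            rcases lt_or_ge i q with h' | h'
            · exact (hgt i hi1 h').le
            · exact hge i h' h
          · exact hleft' i h hi2

end RealRAM

/-! ### Quicksort with median pivots -/

namespace RealRAM

variable {prim : ℕ → ℝ → ℝ → ℝ} {procs : List Cmd}

/-- Sorting a segment by decreasing keys, by quicksort with medians as pivots. -/
def quickSort (B : ℕ) : Cmd :=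
  .cond (.nlt (.add (.var 0) (.lit 1)) (.var 1))
    (.seq (.setNat 2 (.half (.add (.var 0) (.var 1))))
      (.seq (.call (B + 2) [.var 0, .var 1, .var 2] [] 8 1)
        (.seq (.call (B + 3) [.var 0, .var 2] [] 8 1)
          (.call (B + 3) [.add (.var 2) (.lit 1), .var 1] [] 8 1))))
    .skip

theorem log_two_le_of_le_half {a m : ℕ} (ha : a ≤ m / 2) (hm : 2 ≤ m) :
    Nat.log 2 a + 1 ≤ Nat.log 2 m := by
  have h1 : Nat.log 2 a ≤ Nat.log 2 (m / 2) := Nat.log_mono_right ha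
  have h2 := Nat.log_of_one_lt_of_le one_lt_two hm
  omega

/-- The pivot is the middle slot after exact selection, so each half has logarithm smaller by one
and the linear cost is paid once per level. -/
theorem run_quickSort {B : ℕ} (hB1 : procs[B + 1]? = some exchangeSort)
    (hB2 : procs[B + 2]? = some (select B)) (hB3 : procs[B + 3]? = some (quickSort B))
    (s : State) (l r : ℕ) (h0 : s.natVar 0 = l) (h1 : s.natVar 1 = r) :
    Run prim procs (quickSort B) s fun t s' =>
      t ≤ 50100 * (r - l + 1) * (Nat.log 2 (r - l) + 1) ∧ Local l r s s' ∧
        ∀ i j, l ≤ i → i ≤ j → j < r → s'.key j ≤ s'.key i := by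
  induction hn : r - l using Nat.strong_induction_on generalizing s l r with
  | _ n ih =>
    subst hn
    refine run_cond (fun hc => ?_) (fun hc => ?_)
    · simp only [BExp.eval, NExp.eval, h0, h1] at hc
      simp only [run_seq, run_setNat]
      obtain ⟨c, hcdef⟩ : ∃ c, c = (l + r) / 2 := ⟨_, rfl⟩
      refine run_call hB2 ((run_select hB1 hB2 _ l r c ?_ ?_ ?_ (by omega) (by omega)).mono ?_)
      · simp [h0]
      · simp [h1]
      · simp [h0, h1, hcdef]
      rintro t1 s1 ⟨ht1, loc1, hleft, hright⟩
      refine run_call hB3 ((ih (c - l) (by omega) _ l c ?_ ?_ rfl).mono ?_)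
      · simp [h0]
      · simp [h0, h1, hcdef]
      rintro t2 s2 ⟨ht2, loc2, hsort2⟩
      refine run_call hB3 ((ih (r - (c + 1)) (by omega) _ (c + 1) r ?_ ?_ rfl).mono ?_)
      · simp [h0, h1, hcdef]
      · simp [h1]
      rintro t3 s3 ⟨ht3, loc3, hsort3⟩
      replace loc1 : Local l r s s1 := (Local.of_eq rfl rfl).trans loc1
      replace loc2 : Local l c s1 s2 := (Local.of_eq rfl rfl).trans loc2
      replace loc3 : Local (c + 1) r s2 s3 := (Local.of_eq rfl rfl).trans loc3
      refine ⟨?_, ?_, ?_⟩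
      · have e1 : 50100 * (c - l + 1) * (Nat.log 2 (c - l) + 1) ≤
            50100 * (c - l + 1) * Nat.log 2 (r - l) :=
          Nat.mul_le_mul_left _ (log_two_le_of_le_half (by omega) (by omega))
        have e2 : 50100 * (r - (c + 1) + 1) * (Nat.log 2 (r - (c + 1)) + 1) ≤
            50100 * (r - (c + 1) + 1) * Nat.log 2 (r - l) :=
          Nat.mul_le_mul_left _ (log_two_le_of_le_half (by omega) (by omega))
        -- The summand `1` in the time bound makes the weights of the two halves add up exactly,
        -- since the pivot slot drops out.
        have e3 : r - l + 1 = (c - l + 1) + (r - (c + 1) + 1) := by omega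
        have e4 : 50100 * (r - l + 1) * (Nat.log 2 (r - l) + 1) =
            50100 * (c - l + 1) * Nat.log 2 (r - l) +
              50100 * (r - (c + 1) + 1) * Nat.log 2 (r - l) + 50100 * (r - l + 1) := by
          rw [e3]; ring
        simp
        omega
      · exact loc1.trans (((loc2.mono le_rfl (by omega)).trans
          (loc3.mono (by omega) le_rfl)).trans (Local.of_eq rfl rfl))
      · intro i j hi hij hj
        have hmid : s3.key c = s1.key c := by
          rw [loc3.key_outside (by omega), loc2.key_outside (by omega)]
        have hl : ∀ i, l ≤ i → i < c → s1.key c ≤ s3.key i := fun i hi1 hi2 => by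
          rw [loc3.key_outside (by omega)]
          exact loc2.key_forall (P := fun x => s1.key c ≤ x) hleft i hi1 hi2
        have hr : ∀ i, c < i → i < r → s3.key i ≤ s1.key c := fun i hi1 hi2 => by
          refine loc3.key_forall (P := fun x => x ≤ s1.key c) (fun i hi1 hi2 => ?_) i hi1 hi2
          rw [loc2.key_outside (by omega)]
          exact hright i hi1 hi2
        change s3.key j ≤ s3.key i
        rcases lt_trichotomy i c with h | h | h
        · rcases lt_trichotomy j c with h' | h' | h'
          · rw [loc3.key_outside (by omega), loc3.key_outside (by omega)]
            exact hsort2 i j hi hij h'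
          · rw [h', hmid]
            exact hl i hi h
          · exact (hr j h' hj).trans (hl i hi h)
        · rcases hij.eq_or_lt with h' | h'
          · rw [h']
          · rw [h, hmid]
            exact hr j (by omega) hj
        · exact hsort3 i j h hij hj
    · simp only [BExp.eval, NExp.eval, h0, h1, not_lt] at hc
      rw [run_skip]
      refine ⟨?_, Local.of_eq rfl rfl, fun i j hi hij hj => ?_⟩
      · have : 50100 * 1 * 1 ≤ 50100 * (r - l + 1) * (Nat.log 2 (r - l) + 1) := by
          gcongr <;> omega
        simp
        omega
      · obtain rfl : i = j := by omega
        exact le_rfl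

/-! ### Scanning for an optimum; positions of medians -/

/-- Finding a best number of positive samples, between the registers `2` and `3`, above the
negative sample in the slot in register `6`; the result is in register `9`. -/
def scanLoop (B : ℕ) : Cmd :=
  .loop (.nlt (.var 7) (.var 3))
    (.seq (.call B [.var 4, .var 5, .add (.sub (.var 6) (.var 4)) (.lit 1), .add (.var 7) (.lit 1)]
        [] 8 2)
      (.seq (.setReal 0 (.add (.var 0) (.add (.var 2)
          (.mul (.div (.ofNat (.lit 2)) (.mul (.ofNat (.var 4)) (.ofNat (.var 5))))
            (.sub (keyAt (.var 7)) (keyAt (.var 6)))))))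
        (.seq (.cond (.rlt (.var 1) (.var 0))
            (.seq (.setReal 1 (.var 0)) (.setNat 9 (.add (.var 7) (.lit 1)))) .skip)
          (.setNat 7 (.add (.var 7) (.lit 1))))))

/-- The specification of a procedure that computes `δ_j(i+1) - δ_j(i)` in at most `κ` steps. -/
def DerivativeSpec (prim : ℕ → ℝ → ℝ → ℝ) (procs : List Cmd) (c : Cmd) (κ p n : ℕ)
    (δ : ℕ → ℕ → ℝ) : Prop :=
  ∀ j i : ℕ, 1 ≤ j → j ≤ n → 1 ≤ i → i ≤ p → ∀ s : State,
    Run prim procs c (s.enter [p, n, j, i] []) fun t s' =>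
      t ≤ κ ∧ s'.realVar 0 = δ j (i + 1) - δ j i ∧ s'.natArr = s.natArr ∧ s'.realArr = s.realArr

/-- Real register `0` carries the partial sum relative to the one at `a`, and real register `1` the
best such value so far. Slots count from `0` and `δ` from `1`, which explains the shifts by one. The
factor `2/(p * n)` arises because lifting a positive sample above a negative one turns an entry from
`-1` into `1`. -/
theorem run_scanLoop {B κ p n : ℕ} {c : Cmd} {δ : ℕ → ℕ → ℝ} (hB : procs[B]? = some c)
    (hc : DerivativeSpec prim procs c κ p n δ) (s : State) (a b m : ℕ) (d : ℕ → ℝ)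
    (h3 : s.natVar 3 = b) (h4 : s.natVar 4 = p) (h5 : s.natVar 5 = n)
    (h6 : s.natVar 6 = m) (h7 : s.natVar 7 = a) (h9 : s.natVar 9 = a) (r0 : s.realVar 0 = 0)
    (r1 : s.realVar 1 = 0) (hab : a ≤ b) (hb : b ≤ p) (hm : p ≤ m) (hm' : m < p + n)
    (hd : ∀ u, u < p → δ (m - p + 1) (u + 2) - δ (m - p + 1) (u + 1) +
      2 / (p * n) * (s.key u - s.key m) = d u) :
    Run prim procs (scanLoop B) s fun t s' =>
      t ≤ (κ + 80) * (b - a) + 10 ∧ s'.natArr = s.natArr ∧ s'.realArr = s.realArr ∧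
        (∀ x, x < 7 → s'.natVar x = s.natVar x) ∧ a ≤ s'.natVar 9 ∧ s'.natVar 9 ≤ b ∧
        ∀ u, a ≤ u → u ≤ b →
          ∑ i ∈ Finset.range u, d i ≤ ∑ i ∈ Finset.range (s'.natVar 9), d i := by
  refine (run_loop
    (fun w => w.natArr = s.natArr ∧ w.realArr = s.realArr ∧
        (∀ x, x < 7 → w.natVar x = s.natVar x) ∧ a ≤ w.natVar 9 ∧ w.natVar 9 ≤ w.natVar 7 ∧
        w.natVar 7 ≤ b ∧
        w.realVar 0 = ∑ i ∈ Finset.range (w.natVar 7), d i - ∑ i ∈ Finset.range a, d i ∧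
        w.realVar 1 = ∑ i ∈ Finset.range (w.natVar 9), d i - ∑ i ∈ Finset.range a, d i ∧
        ∀ u, a ≤ u → u ≤ w.natVar 7 →
          ∑ i ∈ Finset.range u, d i ≤ ∑ i ∈ Finset.range (w.natVar 9), d i)
    (fun w => b - w.natVar 7) (κ + 70) ?_ ?_).mono ?_
  · rintro w ⟨wn, wr, wreg, wa, w9, w7, wcur, wbest, wmax⟩ hw
    simp only [BExp.eval, NExp.eval, wreg 3 (by decide), h3] at hw
    simp only [run_seq, run_setNat, run_setReal]
    have hargs : ([.var 4, .var 5, .add (.sub (.var 6) (.var 4)) (.lit 1),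
        .add (.var 7) (.lit 1)] : List NExp).map (fun e => e.eval w) =
        [p, n, m - p + 1, w.natVar 7 + 1] := by
      simp [wreg, h4, h5, h6]
    refine run_call hB ?_
    rw [hargs]
    refine (hc (m - p + 1) (w.natVar 7 + 1) (by omega) (by omega) (by omega) (by omega) w).mono ?_
    rintro t u ⟨ht, hval, un, ur⟩
    have hkey : ∀ i, u.key i = s.key i := fun i => by simp [State.key, un, ur, wn, wr]
    have hcur : w.realVar 0 + (u.realVar 0 + 2 / (p * n) * (s.key (w.natVar 7) - s.key m)) =
        ∑ i ∈ Finset.range (w.natVar 7 + 1), d i - ∑ i ∈ Finset.range a, d i := by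
      rw [Finset.sum_range_succ, ← hd _ (by omega), wcur, hval]
      ring
    refine run_cond (fun hlt => ?_) (fun hlt => ?_)
    · simp [wreg, h4, h5, h6, hkey, hcur, wbest] at hlt
      simp [wreg, h4, h5, h6, hkey, hcur]
      refine ⟨by omega, by omega, un.trans wn, ur.trans wr, ?_, by omega, by omega, ?_⟩
      · intro x hx
        rw [if_neg (by omega), if_neg (by omega), if_neg (by omega)]
        exact wreg x hx
      · intro v hv1 hv2
        rcases hv2.eq_or_lt with rfl | h
        · exact le_rfl
        · exact (wmax v hv1 (by omega)).trans hlt.le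
    · simp [wreg, h4, h5, h6, hkey, hcur, wbest] at hlt
      simp [wreg, h4, h5, h6, hkey, hcur]
      refine ⟨by omega, by omega, un.trans wn, ur.trans wr, ?_, by omega, by omega, by omega,
        wbest, ?_⟩
      · intro x hx
        rw [if_neg (by omega), if_neg (by omega)]
        exact wreg x hx
      · intro v hv1 hv2
        rcases hv2.eq_or_lt with rfl | h
        · exact hlt
        · exact wmax v hv1 (by omega)
  · refine ⟨rfl, rfl, fun _ _ => rfl, h9.ge, by omega, by omega, by simp [h7, r0],
      by simp [h9, r1], fun u hu1 hu2 => ?_⟩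
    rw [show u = a by omega, h9]
  · rintro t w ⟨ht, ⟨wn, wr, wreg, wa, w9, w7, wcur, wbest, wmax⟩, hw⟩
    simp only [BExp.eval, NExp.eval, wreg 3 (by decide), h3, not_lt] at hw
    simp [h7] at ht
    refine ⟨ht.trans ?_, wn, wr, wreg, wa, by omega, fun u hu1 hu2 => wmax u hu1 (by omega)⟩
    have : 4 + (κ + 70) ≤ κ + 80 := by omega
    gcongr
    omega

/-- The keys of the slots in `[L, c)` are at least those of the slots in `[c, N)`. -/
def Separated (L N c : ℕ) (s : State) : Prop :=
  ∀ i j, L ≤ i → i < c → c ≤ j → j < N → s.key j ≤ s.key i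

/-- A rearrangement inside a segment that does not straddle `c` moves no key from one side of `c` to
the other. -/
theorem Separated.of_local {L N c l r : ℕ} {s s' : State} (h : Separated L N c s)
    (hloc : Local l r s s') (hl : L ≤ l) (hr : r ≤ N) (hc : c ≤ l ∨ r ≤ c) :
    Separated L N c s' := by
  obtain ⟨σ, hσ, hk⟩ := hloc.exists_key
  intro i j hi hic hcj hj
  rw [hk, hk]
  have mem : ∀ x, (l ≤ σ x ∧ σ x < r ∧ l ≤ x ∧ x < r) ∨ σ x = x := fun x => by
    by_cases hx : l ≤ x ∧ x < r
    · have := (perm_mem_segment hσ).2 hx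
      omega
    · exact Or.inr (hσ x (by omega))
  have hi' := mem i
  have hj' := mem j
  exact h _ _ (by omega) (by omega) (by omega) (by omega)

/-- If the key in slot `m` of `s` were larger, then `s` would have at least `m + 1 - L` keys of that
size or more, but `s'` at most `m - L`. Applied in both directions, this identifies a selected key
with the key in the same slot of the sorted arrangement. -/
theorem key_le_key_of_count_eq {L N m : ℕ} {s s' : State} (hL : L ≤ m) (hN : m < N)
    (hcount : ∀ P, count P L N s = count P L N s')
    (h : ∀ i, L ≤ i → i ≤ m → s.key m ≤ s.key i)
    (h' : ∀ j, m ≤ j → j < N → s'.key j ≤ s'.key m) : s.key m ≤ s'.key m := by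
  by_contra! hlt
  have e := hcount fun x => s.key m ≤ x
  rw [count_split _ (by omega : L ≤ m + 1) (by omega),
    count_eq_length (l := L) (fun i hi1 hi2 => h i hi1 (by omega)),
    count_split _ hL hN.le (s := s'), count_eq_zero (P := fun x => s.key m ≤ x) (l := m)
      (fun j hj1 hj2 => not_le.2 ((h' j hj1 hj2).trans_lt hlt))] at e
  have := count_le (fun x => s.key m ≤ x) L m s'
  omega

end RealRAM

/-! ### Divide and conquer over the negative samples -/

namespace RealRAM

variable {prim : ℕ → ℝ → ℝ → ℝ} {procs : List Cmd}

/-- Up to a constant factor, the running time of `interleave` on `m` negative samples and an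
interval of `w + 1` numbers of positive samples. -/
noncomputable def interleaveBound (m w : ℕ) : ℝ :=
  m * (1 + 2 * Real.logb 2 (w + 1)) + w * m.size + (2 * m + 1)

/-- This is the inequality `2(u+1)(v+1) ≤ (u+v+1)²`, which fails only for `u = v = 0`; that is why
intervals with a single candidate are treated separately. -/
theorem two_logb_add_le {u v : ℕ} (h : 1 ≤ u + v) :
    1 + Real.logb 2 (u + 1) + Real.logb 2 (v + 1) ≤ 2 * Real.logb 2 ((u + v : ℕ) + 1) := by
  have hu : (0 : ℝ) < u + 1 := by positivity
  have hv : (0 : ℝ) < v + 1 := by positivity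
  have e : 1 + Real.logb 2 (u + 1) + Real.logb 2 (v + 1) =
      Real.logb 2 (2 * (u + 1) * (v + 1)) := by
    rw [Real.logb_mul (by positivity) hv.ne', Real.logb_mul two_ne_zero hu.ne',
      Real.logb_self_eq_one one_lt_two]
  have e' : 2 * Real.logb 2 ((u + v : ℕ) + 1) = Real.logb 2 (((u + v : ℕ) + 1 : ℝ) ^ 2) := by
    rw [Real.logb_pow]; norm_num
  rw [e, e']
  refine Real.logb_le_logb_of_le one_lt_two (by positivity) ?_
  have : 2 * (u + 1) * (v + 1) ≤ (u + v + 1) ^ 2 := by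
    rcases (show 1 ≤ u ∨ 1 ≤ v by omega) with h | h <;> nlinarith
  exact_mod_cast this

theorem size_half_add_one {m a : ℕ} (ha : a ≤ m / 2) (hm : 1 ≤ m) : a.size + 1 ≤ m.size := by
  have h1 : a.size ≤ (m / 2).size := Nat.size_le_size ha
  have h2 : m.size = (m / 2).size + 1 := by
    conv_lhs => rw [← Nat.bit_testBit_zero_shiftRight_one m]
    rw [Nat.size_bit, Nat.shiftRight_one]
    rw [Nat.bit_testBit_zero_shiftRight_one]
    omega
  omega

/-- Each summand absorbs one cost. The logarithmic one absorbs `m`, since both parts have size at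
most `m / 2` and `two_logb_add_le` applies; `w * m.size` absorbs the scan, as the size drops with
every halving while the widths add up to `w`; and `2 * m + 1` absorbs the constant cost per call,
including calls on empty segments. -/
theorem interleaveBound_step {m m₁ m₂ w₁ w₂ : ℕ} (h₁ : m₁ ≤ m / 2) (h₂ : m₂ ≤ m / 2)
    (hm : m₁ + m₂ + 1 = m) (hw : 1 ≤ w₁ + w₂) :
    m + (w₁ + w₂ : ℕ) + 1 + interleaveBound m₁ w₁ + interleaveBound m₂ w₂ ≤
      interleaveBound m (w₁ + w₂) := by
  unfold interleaveBound
  have a1 : (m₁ : ℝ) ≤ m / 2 := (Nat.cast_le.2 h₁).trans Nat.cast_div_le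
  have a2 : (m₂ : ℝ) ≤ m / 2 := (Nat.cast_le.2 h₂).trans Nat.cast_div_le
  have s1 : ((m₁.size : ℝ) + 1) ≤ m.size := by exact_mod_cast size_half_add_one h₁ (by omega)
  have s2 : ((m₂.size : ℝ) + 1) ≤ m.size := by exact_mod_cast size_half_add_one h₂ (by omega)
  have hl := two_logb_add_le hw
  have l1 : 0 ≤ Real.logb 2 (w₁ + 1) := Real.logb_nonneg one_lt_two (by simp)
  have l2 : 0 ≤ Real.logb 2 (w₂ + 1) := Real.logb_nonneg one_lt_two (by simp)
  have hm' : (m₁ : ℝ) + m₂ + 1 = m := by exact_mod_cast hm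
  have b1 := mul_le_mul_of_nonneg_right a1 (by positivity : 0 ≤ 1 + 2 * Real.logb 2 (w₁ + 1))
  have b2 := mul_le_mul_of_nonneg_right a2 (by positivity : 0 ≤ 1 + 2 * Real.logb 2 (w₂ + 1))
  have c1 := mul_le_mul_of_nonneg_left s1 (Nat.cast_nonneg (α := ℝ) w₁)
  have c2 := mul_le_mul_of_nonneg_left s2 (Nat.cast_nonneg (α := ℝ) w₂)
  have d := mul_le_mul_of_nonneg_left hl (Nat.cast_nonneg (α := ℝ) m)
  push_cast at d ⊢
  nlinarith

/-- Differences of partial sums are monotone in the summands. -/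
theorem sum_range_sub_le {f g : ℕ → ℝ} {p o i : ℕ} (h : ∀ u, u < p → f u ≤ g u) (hoi : o ≤ i)
    (hi : i ≤ p) :
    ∑ u ∈ Finset.range i, f u - ∑ u ∈ Finset.range o, f u ≤
      ∑ u ∈ Finset.range i, g u - ∑ u ∈ Finset.range o, g u := by
  rw [← Finset.sum_Ico_eq_sub _ hoi, ← Finset.sum_Ico_eq_sub _ hoi]
  exact Finset.sum_le_sum fun u hu => h u ((Finset.mem_Ico.1 hu).2.trans_le hi)

/-- The partial sums of `d` up to `p` are maximal at `o`. -/
def IsBest (p : ℕ) (d : ℕ → ℝ) (o : ℕ) : Prop :=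
  o ≤ p ∧ ∀ u, u ≤ p → ∑ i ∈ Finset.range u, d i ≤ ∑ i ∈ Finset.range o, d i

/-- If a maximizer `u` for `f` exceeds `o`, then passing from `o` to `u` gains no more for `f` than
for `g`, and nothing for `g`; hence `o` is itself a maximizer for `f`. -/
theorem IsBest.exists_le {p a o b : ℕ} {f g : ℕ → ℝ} (h : ∀ u, u < p → f u ≤ g u)
    (hg : IsBest p g o) (hao : a ≤ o) (hf : ∃ u, a ≤ u ∧ u ≤ b ∧ IsBest p f u) :
    ∃ u, a ≤ u ∧ u ≤ o ∧ IsBest p f u := by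
  obtain ⟨u, hau, -, hup, hu⟩ := hf
  rcases le_total u o with huo | hou
  · exact ⟨u, hau, huo, hup, hu⟩
  · refine ⟨o, hao, le_rfl, hg.1, fun v hv => (hu v hv).trans ?_⟩
    have := sum_range_sub_le h hou hup
    have := hg.2 u hup
    linarith

/-- The mirror image: from a maximizer `u < o`, going up to `o` gains at least as much for `f` as
for `g`, which is nonnegative. -/
theorem IsBest.exists_ge {p a o b : ℕ} {f g : ℕ → ℝ} (h : ∀ u, u < p → g u ≤ f u)
    (hg : IsBest p g o) (hob : o ≤ b) (hf : ∃ u, a ≤ u ∧ u ≤ b ∧ IsBest p f u) :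
    ∃ u, o ≤ u ∧ u ≤ b ∧ IsBest p f u := by
  obtain ⟨u, -, hub, hup, hu⟩ := hf
  rcases le_total o u with hou | huo
  · exact ⟨u, hou, hub, hup, hu⟩
  · refine ⟨o, le_rfl, hob, hg.1, fun v hv => (hu v hv).trans ?_⟩
    have := sum_range_sub_le h huo hg.1
    have := hg.2 u hup
    linarith

/-- Assigning optimal numbers of positive samples to the negative samples in the slots `[l, r)`,
given that they lie in `[a, b]`; the arguments are `l`, `r`, `a`, `b`, `p`, `n`. -/
def interleave (B : ℕ) : Cmd :=
  .cond (.nlt (.var 0) (.var 1))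
    (.cond (.nlt (.var 2) (.var 3))
      (.seq (.setNat 6 (.half (.add (.var 0) (.var 1))))
      (.seq (.call (B + 2) [.var 0, .var 1, .var 6] [] 8 3)
      (.seq (.setReal 0 (.ofNat (.lit 0))) (.seq (.setReal 1 (.ofNat (.lit 0)))
      (.seq (.setNat 7 (.var 2)) (.seq (.setNat 9 (.var 2))
      (.seq (scanLoop B)
      (.seq (.putNat 2 (.var 6) (.var 9))
      (.seq (.call (B + 4) [.var 0, .var 6, .var 2, .var 9, .var 4, .var 5] [] 8 3)
        (.call (B + 4) [.add (.var 6) (.lit 1), .var 1, .var 9, .var 3, .var 4, .var 5]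
          [] 8 3))))))))))
      (.loop (.nlt (.var 0) (.var 1))
        (.seq (.putNat 2 (.var 0) (.var 2)) (.setNat 0 (.add (.var 0) (.lit 1))))))
    .skip

/-- What is required of the memory when `interleave` is called for the slots `[l, r)`. -/
structure InterleavePre (p n l r : ℕ) (s₀ s : State) : Prop where
  key_pos : ∀ i, i < p → s.key i = s₀.key i
  count_eq : ∀ P, count P p (p + n) s = count P p (p + n) s₀
  sep_left : Separated p (p + n) l s
  sep_right : Separated p (p + n) r s

/-- What `interleave` achieves in the slots `[l, r)`. -/
structure InterleavePost (p : ℕ) (d : ℕ → ℕ → ℝ) (l r a b : ℕ) (s' : State) : Prop where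
  mem : ∀ j, l ≤ j → j < r → a ≤ s'.natArr 2 j ∧ s'.natArr 2 j ≤ b ∧ IsBest p (d j) (s'.natArr 2 j)
  mono : ∀ i j, l ≤ i → i < j → j < r → s'.natArr 2 i ≤ s'.natArr 2 j ∧
    (s'.natArr 2 i < s'.natArr 2 j → s'.key j ≤ s'.key i)

theorem InterleavePre.of_local {p n l r l' r' : ℕ} {s₀ s s' : State}
    (h : InterleavePre p n l r s₀ s) (hloc : Local l' r' s s') (hl : l ≤ l') (hr : r' ≤ r)
    (hp : p ≤ l) (hrn : r ≤ p + n) : InterleavePre p n l r s₀ s' where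
  key_pos i hi := (hloc.key_outside (by omega)).trans (h.key_pos i hi)
  count_eq P := ((hloc.mono (by omega) (by omega)).count_eq P).trans (h.count_eq P)
  sep_left := h.sep_left.of_local hloc (by omega) (by omega) (by omega)
  sep_right := h.sep_right.of_local hloc (by omega) (by omega) (by omega)

theorem run_assignLoop (s : State) (l r a : ℕ) (h0 : s.natVar 0 = l) (h1 : s.natVar 1 = r)
    (h2 : s.natVar 2 = a) (hlr : l ≤ r) :
    Run prim procs (.loop (.nlt (.var 0) (.var 1))
      (.seq (.putNat 2 (.var 0) (.var 2)) (.setNat 0 (.add (.var 0) (.lit 1))))) s fun t s' =>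
      t ≤ 20 * (r - l) + 4 ∧ Local l r s s' ∧ ∀ j, l ≤ j → j < r → s'.natArr 2 j = a := by
  refine (run_loop
    (fun u => u.natVar 1 = r ∧ u.natVar 2 = a ∧ l ≤ u.natVar 0 ∧ u.natVar 0 ≤ r ∧
      u.realArr = s.realArr ∧ u.natArr 1 = s.natArr 1 ∧
      (∀ j, l ≤ j → j < u.natVar 0 → u.natArr 2 j = a) ∧
      ∀ j, j < l ∨ r ≤ j → u.natArr 2 j = s.natArr 2 j)
    (fun u => r - u.natVar 0) 16 ?_ ?_).mono ?_
  · rintro u ⟨u1, u2, hl, hr, ureal, unat, hin, hout⟩ hb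
    simp only [BExp.eval, NExp.eval, u1] at hb
    simp [u1, u2, ureal, unat]
    refine ⟨by omega, by omega, by omega, fun j hj1 hj2 => ?_, fun j hj => ?_⟩
    · rw [Function.update_apply]
      split_ifs with h
      · rfl
      · exact hin j hj1 (by omega)
    · rw [Function.update_of_ne (by omega)]
      exact hout j hj
  · exact ⟨h1, h2, h0.ge, by omega, rfl, rfl, fun j _ _ => by omega, fun _ _ => rfl⟩
  · rintro t u ⟨ht, ⟨u1, u2, hl, hr, ureal, unat, hin, hout⟩, hb⟩
    simp only [BExp.eval, NExp.eval, u1, not_lt] at hb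
    simp [h0] at ht
    exact ⟨ht, ⟨ureal, hout, 1, fun _ _ => rfl, unat⟩, fun j hj1 hj2 => hin j hj1 (by omega)⟩

/-- `s₀` is a fully sorted reference arrangement that fixes the increments `d`; the segment itself
is only ordered as far as needed. Separation at both ends of the segment ensures that the local
median has its final global rank, so that its index and its key agree with `s₀`. -/
theorem run_interleave {B κ p n : ℕ} {c : Cmd} {δ : ℕ → ℕ → ℝ} (hB : procs[B]? = some c)
    (hc : DerivativeSpec prim procs c κ p n δ) (hB1 : procs[B + 1]? = some exchangeSort)
    (hB2 : procs[B + 2]? = some (select B)) (hB4 : procs[B + 4]? = some (interleave B))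
    (d : ℕ → ℕ → ℝ) (s₀ : State)
    (hd : ∀ j u, p ≤ j → j < p + n → u < p → δ (j - p + 1) (u + 2) - δ (j - p + 1) (u + 1) +
      2 / (p * n) * (s₀.key u - s₀.key j) = d j u)
    (hmono : ∀ i j u, p ≤ i → i ≤ j → j < p + n → u < p → d i u ≤ d j u)
    (hsorted : ∀ i j, p ≤ i → i ≤ j → j < p + n → s₀.key j ≤ s₀.key i)
    (s : State) (l r a b : ℕ) (h0 : s.natVar 0 = l) (h1 : s.natVar 1 = r) (h2 : s.natVar 2 = a)
    (h3 : s.natVar 3 = b) (h4 : s.natVar 4 = p) (h5 : s.natVar 5 = n) (hpl : p ≤ l) (hlr : l ≤ r)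
    (hrn : r ≤ p + n) (hab : a ≤ b) (hbp : b ≤ p) (hpre : InterleavePre p n l r s₀ s)
    (hbest : ∀ j, l ≤ j → j < r → ∃ u, a ≤ u ∧ u ≤ b ∧ IsBest p (d j) u) :
    Run prim procs (interleave B) s fun t s' =>
      (t : ℝ) ≤ (κ + 60000) * interleaveBound (r - l) (b - a) ∧ Local l r s s' ∧
        InterleavePost p d l r a b s' := by
  induction hm : r - l using Nat.strong_induction_on generalizing s l r a b with
  | _ m ih =>
    subst hm
    refine run_cond (fun hlt => ?_) (fun hlt => ?_)
    swap
    · simp only [BExp.eval, NExp.eval, h0, h1, not_lt] at hlt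
      rw [run_skip]
      obtain rfl : l = r := by omega
      refine ⟨?_, Local.of_eq rfl rfl, fun j _ _ => by omega, fun i j _ _ _ => by omega⟩
      simp [interleaveBound]
      linarith [Nat.cast_nonneg (α := ℝ) κ]
    simp only [BExp.eval, NExp.eval, h0, h1] at hlt
    refine run_cond (fun hw => ?_) (fun hw => ?_)
    swap
    · simp only [BExp.eval, NExp.eval, h2, h3, not_lt] at hw
      -- With a single candidate left, the order inside the segment is irrelevant, and linear time
      -- suffices.
      obtain rfl : a = b := by omega
      refine (run_assignLoop s l r a h0 h1 h2 hlr).mono ?_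
      rintro t s' ⟨ht, hloc, hval⟩
      refine ⟨?_, hloc, fun j hj1 hj2 => ?_, fun i j hi hij hj => ?_⟩
      · have ht' : (t : ℝ) ≤ 20 * (r - l : ℕ) + 4 := by exact_mod_cast ht
        have := Nat.cast_nonneg (α := ℝ) κ
        have := Nat.cast_nonneg (α := ℝ) (r - l)
        simp [interleaveBound]
        nlinarith
      · obtain ⟨u, hu1, hu2, hu⟩ := hbest j hj1 hj2
        obtain rfl : u = a := by omega
        rw [hval j hj1 hj2]
        exact ⟨le_rfl, le_rfl, hu⟩
      · rw [hval i hi (by omega), hval j (by omega) hj]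
        exact ⟨le_rfl, fun h => absurd h (lt_irrefl _)⟩
    simp only [BExp.eval, NExp.eval, h2, h3] at hw
    simp only [run_seq, run_setNat, run_setReal]
    obtain ⟨c, hcdef⟩ : ∃ c, c = (l + r) / 2 := ⟨_, rfl⟩
    have hlc : l ≤ c := by omega
    have hcr : c < r := by omega
    refine run_call hB2 ((run_select hB1 hB2 _ l r c ?_ ?_ ?_ hlc hcr).mono ?_)
    · simp [h0]
    · simp [h1]
    · simp [h0, h1, hcdef]
    rintro t1 s1 ⟨ht1, loc1, hleft, hright⟩
    replace loc1 : Local l r s s1 := (Local.of_eq rfl rfl).trans loc1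
    have pre1 : InterleavePre p n l r s₀ s1 := hpre.of_local loc1 le_rfl le_rfl hpl hrn
    have sep1 : Separated p (p + n) c s1 := by
      intro i j hi hic hcj hj
      rcases lt_or_ge i l with h | h
      · exact pre1.sep_left i j hi h (by omega) hj
      rcases lt_or_ge j r with h' | h'
      · rcases hcj.eq_or_lt with rfl | h''
        · exact hleft i h hic
        · exact (hright j h'' h').trans (hleft i h hic)
      · exact pre1.sep_right i j hi (by omega) h' hj
    have sep1' : Separated p (p + n) (c + 1) s1 := by
      intro i j hi hic hcj hj
      rcases lt_or_ge i l with h | h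
      · exact pre1.sep_left i j hi h (by omega) hj
      rcases lt_or_ge j r with h' | h'
      · rcases (show i = c ∨ i < c by omega) with rfl | h''
        · exact hright j hcj h'
        · exact (hright j hcj h').trans (hleft i h h'')
      · exact pre1.sep_right i j hi (by omega) h' hj
    -- Slot `c` is now separated from both sides globally, so it holds the same order statistic as
    -- in the sorted arrangement.
    have hkey : s1.key c = s₀.key c := by
      refine le_antisymm ?_ ?_
      · refine key_le_key_of_count_eq (L := p) (N := p + n) (by omega) (by omega) pre1.count_eq
          (fun i hi1 hi2 => ?_) fun j hj1 hj2 => hsorted c j (by omega) hj1 hj2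
        rcases hi2.eq_or_lt with rfl | h
        · exact le_rfl
        · exact sep1 i c hi1 h le_rfl (by omega)
      · refine key_le_key_of_count_eq (L := p) (N := p + n) (by omega) (by omega)
          (fun P => (pre1.count_eq P).symm) (fun i hi1 hi2 => hsorted i c hi1 hi2 (by omega))
          fun j hj1 hj2 => ?_
        rcases hj1.eq_or_lt with rfl | h
        · exact le_rfl
        · exact sep1' c j (by omega) (by omega) (by omega) hj2
    refine (run_scanLoop hB hc _ a b c (d c) ?_ ?_ ?_ ?_ ?_ ?_ ?_ ?_ hab hbp (by omega) (by omega)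
      ?_).mono ?_
    · simp [h3]
    · simp [h4]
    · simp [h5]
    · simp [h0, h1, hcdef]
    · simp [h2]
    · simp [h2]
    · simp
    · simp
    · intro u hu
      simp only [key_setNat, key_setReal, key_leave]
      rw [pre1.key_pos u hu, hkey]
      exact hd c u (by omega) (by omega) hu
    rintro t2 s2 ⟨ht2, nat2, real2, reg2, hao, hob, hmax⟩
    have q0 : s2.natVar 0 = l := by rw [reg2 0 (by decide)]; simp [h0]
    have q1 : s2.natVar 1 = r := by rw [reg2 1 (by decide)]; simp [h1]
    have q2 : s2.natVar 2 = a := by rw [reg2 2 (by decide)]; simp [h2]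
    have q3 : s2.natVar 3 = b := by rw [reg2 3 (by decide)]; simp [h3]
    have q4 : s2.natVar 4 = p := by rw [reg2 4 (by decide)]; simp [h4]
    have q5 : s2.natVar 5 = n := by rw [reg2 5 (by decide)]; simp [h5]
    have q6 : s2.natVar 6 = c := by rw [reg2 6 (by decide)]; simp [h0, h1, hcdef]
    clear reg2
    obtain ⟨o, ho⟩ : ∃ o, o = s2.natVar 9 := ⟨_, rfl⟩
    rw [← ho] at hao hob hmax
    -- The scan compares only candidates in `[a, b]`, but `hbest` puts a maximizer over all of `[0,
    -- p]` there.
    have hbesto : IsBest p (d c) o := by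
      refine ⟨by omega, fun v hv => ?_⟩
      obtain ⟨u, hu1, hu2, hu⟩ := hbest c hlc hcr
      exact (hu.2 v hv).trans (hmax u hu1 hu2)
    rw [run_putNat]
    simp only [NExp.eval, q6, ← ho]
    have loc2 : Local l r s1 (s2.putNat 2 c o) := by
      refine ⟨real2, fun i hi => ?_, 1, fun _ _ => rfl, ?_⟩
      · rw [putNat_natArr, if_pos rfl, Function.update_of_ne (by omega), nat2]
        rfl
      · rw [putNat_natArr, if_neg (by decide), nat2]
        rfl
    have key2 : ∀ i, (s2.putNat 2 c o).key i = s1.key i := fun i => by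
      rw [key_putNat_two]
      simp only [State.key, nat2, real2]
      rfl
    have pre2 : InterleavePre p n l r s₀ (s2.putNat 2 c o) :=
      pre1.of_local loc2 le_rfl le_rfl hpl hrn
    have sep2 : Separated p (p + n) c (s2.putNat 2 c o) := fun i j hi hic hcj hj => by
      rw [key2, key2]
      exact sep1 i j hi hic hcj hj
    have sep2' : Separated p (p + n) (c + 1) (s2.putNat 2 c o) := fun i j hi hic hcj hj => by
      rw [key2, key2]
      exact sep1' i j hi hic hcj hj
    refine run_call hB4 ((ih (c - l) (by omega) _ l c a o ?_ ?_ ?_ ?_ ?_ ?_ hpl hlc (by omega) hao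
      (by omega) ?_ ?_ rfl).mono ?_)
    · simp [q0]
    · simp [q6]
    · simp [q2]
    · simp [ho]
    · simp [q4]
    · simp [q5]
    · exact ⟨pre2.key_pos, pre2.count_eq, pre2.sep_left, sep2⟩
    · intro j hj1 hj2
      exact hbesto.exists_le (fun u hu => hmono j c u (by omega) hj2.le (by omega) hu) hao
        (hbest j hj1 (by omega))
    rintro t3 s3 ⟨ht3, loc3, post3⟩
    replace loc3 : Local l c (s2.putNat 2 c o) s3 := (Local.of_eq rfl rfl).trans loc3
    have pre3 := pre2.of_local loc3 le_rfl hcr.le hpl hrn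
    have sep3 := sep2.of_local loc3 hpl (by omega) (Or.inr le_rfl)
    have sep3' := sep2'.of_local loc3 hpl (by omega) (Or.inr (by omega))
    refine run_call hB4 ((ih (r - (c + 1)) (by omega) _ (c + 1) r o b ?_ ?_ ?_ ?_ ?_ ?_ (by omega)
      hcr (by omega) hob (by omega) ?_ ?_ rfl).mono ?_)
    · simp [q6]
    · simp [q1]
    · simp [ho]
    · simp [q3]
    · simp [q4]
    · simp [q5]
    · exact ⟨pre3.key_pos, pre3.count_eq, sep3', pre3.sep_right⟩
    · intro j hj1 hj2
      exact hbesto.exists_ge (fun u hu => hmono c j u (by omega) (by omega) (by omega) hu) hob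
        (hbest j (by omega) hj2)
    rintro t4 s4 ⟨ht4, loc4, post4⟩
    replace loc4 : Local (c + 1) r s3 s4 := (Local.of_eq rfl rfl).trans loc4
    have sep4 := sep3.of_local loc4 (by omega) (by omega) (Or.inl (by omega))
    have sep4' := sep3'.of_local loc4 (by omega) (by omega) (Or.inl (by omega))
    have valc : s4.natArr 2 c = o := by
      rw [loc4.2.1 c (by omega), loc3.2.1 c (by omega)]
      simp
    have vall : ∀ j, l ≤ j → j < c → s4.natArr 2 j = s3.natArr 2 j := fun j _ hj =>
      loc4.2.1 j (by omega)
    refine ⟨?_, ?_, ?_, ?_⟩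
    · have hstep := interleaveBound_step (m := r - l) (m₁ := c - l) (m₂ := r - (c + 1))
        (w₁ := o - a) (w₂ := b - o) (by omega) (by omega) (by omega) (by omega)
      rw [show o - a + (b - o) = b - a by omega] at hstep
      have ht1' : (t1 : ℝ) ≤ 50000 * (r - l : ℕ) := by exact_mod_cast ht1
      have ht2' : (t2 : ℝ) ≤ (κ + 80) * (b - a : ℕ) + 10 := by exact_mod_cast ht2
      have hκ := Nat.cast_nonneg (α := ℝ) κ
      have hml := Nat.cast_nonneg (α := ℝ) (r - l)
      have hba := Nat.cast_nonneg (α := ℝ) (b - a)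
      have hmul := mul_le_mul_of_nonneg_left hstep (by positivity : (0 : ℝ) ≤ κ + 60000)
      clear * - ht1' ht2' hκ hml hba hmul ht3 ht4
      simp
      nlinarith
    · exact loc1.trans (loc2.trans ((loc3.mono le_rfl hcr.le).trans
        ((loc4.mono (by omega) le_rfl).trans (Local.of_eq rfl rfl))))
    · intro j hj1 hj2
      change a ≤ s4.natArr 2 j ∧ s4.natArr 2 j ≤ b ∧ IsBest p (d j) (s4.natArr 2 j)
      rcases lt_trichotomy j c with h | rfl | h
      · rw [vall j hj1 h]
        have := post3.mem j hj1 h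
        exact ⟨this.1, this.2.1.trans hob, this.2.2⟩
      · rw [valc]
        exact ⟨hao, hob, hbesto⟩
      · have := post4.mem j h hj2
        exact ⟨hao.trans this.1, this.2.1, this.2.2⟩
    · intro i j hi hij hj
      change s4.natArr 2 i ≤ s4.natArr 2 j ∧ (s4.natArr 2 i < s4.natArr 2 j → s4.key j ≤ s4.key i)
      rcases lt_trichotomy i c with h | rfl | h
      · have h3i := post3.mem i hi h
        rw [vall i hi h]
        rcases lt_trichotomy j c with h' | rfl | h'
        · rw [vall j (by omega) h', loc4.key_outside (by omega), loc4.key_outside (by omega)]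
          exact post3.mono i j hi hij h'
        · rw [valc]
          exact ⟨h3i.2.1, fun _ => sep4 i j (by omega) hij le_rfl (by omega)⟩
        · exact ⟨h3i.2.1.trans (post4.mem j h' hj).1,
            fun _ => sep4 i j (by omega) h (by omega) (by omega)⟩
      · rw [valc]
        exact ⟨(post4.mem j hij hj).1, fun _ => sep4' i j (by omega) (by omega) hij (by omega)⟩
      · exact post4.mono i j h hij hj

end RealRAM

/-! ### The objective and a certificate of optimality -/

namespace Ranking

/-- The sum of the values of an antitone sequence over a set of `u` indices is at most the sum of
its first `u` values. -/
theorem sum_le_sum_range_card {p : ℕ} {f : ℕ → ℝ} (hf : ∀ i j, i ≤ j → j < p → f j ≤ f i)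
    {T : Finset ℕ} (hT : ∀ i ∈ T, i < p) : ∑ i ∈ T, f i ≤ ∑ i ∈ Finset.range T.card, f i := by
  rcases Nat.eq_zero_or_pos T.card with h0 | hpos
  · rw [Finset.card_eq_zero.1 h0]; simp
  have hle : T.card ≤ p := by
    have := Finset.card_le_card (t := Finset.range p) fun i hi => Finset.mem_range.2 (hT i hi)
    simpa using this
  rw [← Finset.sum_sdiff_le_sum_sdiff]
  have hcard : (T \ Finset.range T.card).card = (Finset.range T.card \ T).card := by
    rw [Finset.card_sdiff_comm]; simp
  calc ∑ i ∈ T \ Finset.range T.card, f i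
      ≤ (T \ Finset.range T.card).card • f (T.card - 1) := by
        refine Finset.sum_le_card_nsmul _ _ _ fun i hi => ?_
        simp only [Finset.mem_sdiff, Finset.mem_range, not_lt] at hi
        exact hf _ _ (by omega) (hT i hi.1)
    _ = (Finset.range T.card \ T).card • f (T.card - 1) := by rw [hcard]
    _ ≤ ∑ i ∈ Finset.range T.card \ T, f i := by
        refine Finset.card_nsmul_le_sum _ _ _ fun i hi => ?_
        simp only [Finset.mem_sdiff, Finset.mem_range] at hi
        exact hf _ _ (by omega) (by omega)

/-- The index of an element in the order given by an injective map, as an equivalence. -/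
theorem exists_equiv_card_lt {n N : ℕ} (f : Fin n → Fin N) (hf : Function.Injective f) :
    ∃ e : Fin n ≃ Fin n, (∀ y, (e y : ℕ) = (Finset.univ.filter fun y' => f y' < f y).card) ∧
      ∀ y y', e y < e y' ↔ f y < f y' := by
  have hlt : ∀ y, (Finset.univ.filter fun y' => f y' < f y).card < n := fun y => by
    have : (Finset.univ.filter fun y' => f y' < f y).card < (Finset.univ : Finset (Fin n)).card :=
      Finset.card_lt_card (Finset.filter_ssubset.2 ⟨y, Finset.mem_univ _, lt_irrefl _⟩)
    simpa using this
  let g : Fin n → Fin n := fun y => ⟨_, hlt y⟩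
  have hmono : ∀ y y', f y < f y' → g y < g y' := fun y y' h => by
    change (Finset.univ.filter fun z => f z < f y).card <
      (Finset.univ.filter fun z => f z < f y').card
    refine Finset.card_lt_card ⟨fun z hz => ?_, fun hsub => ?_⟩
    · simp only [Finset.mem_filter, Finset.mem_univ, true_and] at hz ⊢
      exact hz.trans h
    · have := hsub (x := y) (by simpa using h)
      simp at this
  have hinj : Function.Injective g := fun y y' h => by
    rcases lt_trichotomy (f y) (f y') with h' | h' | h'
    · exact absurd h (hmono _ _ h').ne
    · exact hf h'
    · exact absurd h (hmono _ _ h').ne'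
  refine ⟨Equiv.ofBijective g (Finite.injective_iff_bijective.1 hinj), fun y => rfl,
    fun y y' => ⟨fun h => ?_, hmono y y'⟩⟩
  rcases lt_trichotomy (f y) (f y') with h' | h' | h'
  · exact h'
  · exact absurd (congrArg g (hf h')) h.ne
  · exact absurd h (hmono _ _ h').not_gt

section Objective

variable {p n : ℕ} (π : Sample p n ≃ Fin (p + n))

/-- The positive samples above a negative sample. -/
def above (y : Fin n) : Finset (Fin p) :=
  Finset.univ.filter fun x => π (.inl x) < π (.inr y)

theorem ofPositions_eq_one_iff (a b : Sample p n) : ofPositions π a b = 1 ↔ π a < π b := by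
  unfold ofPositions
  split_ifs <;> simp_all

theorem rankNeg_ofPositions (y : Fin n) : rankNeg (ofPositions π) y = (above π y).card + 1 := by
  simp only [rankNeg, above, ofPositions_eq_one_iff, add_comm]

theorem indNeg_ofPositions (y : Fin n) :
    indNeg (ofPositions π) y =
      (Finset.univ.filter fun y' => π (.inr y') < π (.inr y)).card + 1 := by
  simp only [indNeg, ofPositions_eq_one_iff, add_comm]

/-- An entry is twice the indicator of "above" minus one; the second half does not depend on the
ranking. -/
theorem sum_ofPositions (sp : Fin p → ℝ) (c : ℝ) (y : Fin n) :
    ∑ x : Fin p, (ofPositions π (.inl x) (.inr y) : ℝ) * (sp x - c) =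
      2 * (∑ x ∈ above π y, sp x - (above π y).card * c) + (p * c - ∑ x, sp x) := by
  have h : ∀ x : Fin p, (ofPositions π (.inl x) (.inr y) : ℝ) * (sp x - c) =
      2 * (if π (.inl x) < π (.inr y) then sp x - c else 0) + (c - sp x) := fun x => by
    have hne : π (.inl x) ≠ π (.inr y) := π.injective.ne (by simp)
    unfold ofPositions
    split_ifs with h1 h2
    · push_cast; ring
    · push_cast; ring
    · exact absurd (le_antisymm (not_lt.1 h2) (not_lt.1 h1)) hne
  simp only [h, Finset.sum_add_distrib, ← Finset.mul_sum, ← Finset.sum_filter,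
    Finset.sum_sub_distrib]
  simp [above]

theorem objective_ofPositions {Δ : Loss} {δ : ℕ → ℕ → ℕ → ℕ → ℝ} (hΔ : NegDecomposable Δ δ)
    (hp : 1 ≤ p) (hn : 1 ≤ n) (sp : Fin p → ℝ) (sn : Fin n → ℝ) :
    objective Δ sp sn (ofPositions π) =
      ∑ y, (δ p n ((Finset.univ.filter fun y' => π (.inr y') < π (.inr y)).card + 1)
        ((above π y).card + 1) + 2 / (p * n) * (∑ x ∈ above π y, sp x)) -
      2 / (p * n) * ∑ y, ((above π y).card : ℝ) * sn y +
        1 / (p * n) * ∑ y, (p * sn y - ∑ x, sp x) := by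
  unfold objective rankingScore
  rw [hΔ p n hp hn _ ⟨π, rfl⟩, Finset.sum_comm]
  simp only [sum_ofPositions, rankNeg_ofPositions, indNeg_ofPositions, Finset.sum_add_distrib,
    ← Finset.mul_sum, Finset.sum_sub_distrib]
  ring

end Objective

theorem sum_range_derivative (f : ℕ → ℝ) (k : ℕ → ℝ) (c v : ℝ) (u : ℕ) :
    ∑ i ∈ Finset.range u, (f (i + 2) - f (i + 1) + c * (k i - v)) =
      f (u + 1) - f 1 + c * (∑ i ∈ Finset.range u, k i) - c * (u * v) := by
  induction u with
  | zero => simp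
  | succ u ih =>
    rw [Finset.sum_range_succ, ih, Finset.sum_range_succ]
    push_cast
    ring

/-- A ranking whose negative samples get optimal numbers of positive samples above them. -/
theorem isOptimal_of_isBest {Δ : Loss} {δ : ℕ → ℕ → ℕ → ℕ → ℝ} (hΔ : NegDecomposable Δ δ)
    {p n : ℕ} (hp : 1 ≤ p) (hn : 1 ≤ n) (sp : Fin p → ℝ) (sn : Fin n → ℝ) (k : ℕ → ℝ)
    (α : Fin p ≃ Fin p) (β ρ : Fin n ≃ Fin n) (v : Fin n → ℝ) (O : Fin n → ℕ)
    (π : Sample p n ≃ Fin (p + n)) (hk : ∀ i : Fin p, k i = sp (α i))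
    (hkanti : ∀ i j, i ≤ j → j < p → k j ≤ k i) (hv : ∀ j, v j = sn (ρ j)) (hvanti : Antitone v)
    (hO : ∀ i j, O i < O j → sn (β j) ≤ sn (β i))
    (hbest : ∀ j : Fin n, RealRAM.IsBest p
      (fun i => δ p n (j + 1) (i + 2) - δ p n (j + 1) (i + 1) + 2 / (p * n) * (k i - v j)) (O j))
    (hπ : ∀ i j, π (.inl (α i)) < π (.inr (β j)) ↔ (i : ℕ) < O j)
    (hπ' : ∀ i j, π (.inr (β i)) < π (.inr (β j)) ↔ i < j) :
    IsOptimal Δ sp sn (ofPositions π) := by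
  refine ⟨⟨π, rfl⟩, ?_⟩
  rintro _ ⟨π', rfl⟩
  rw [objective_ofPositions π' hΔ hp hn, objective_ofPositions π hΔ hp hn]
  gcongr ?_ + _
  have hc : (0 : ℝ) ≤ 2 / (p * n) := by positivity
  -- Maximality of partial sums, telescoped by `sum_range_derivative`, becomes maximality of `G_j`
  -- itself.
  have hG : ∀ (j : Fin n) (u : ℕ), u ≤ p →
      δ p n (j + 1) (u + 1) + 2 / (p * n) * (∑ i ∈ Finset.range u, k i) - 2 / (p * n) * (u * v j) ≤
      δ p n (j + 1) (O j + 1) + 2 / (p * n) * (∑ i ∈ Finset.range (O j), k i) -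
        2 / (p * n) * (O j * v j) := fun j u hu => by
    have := (hbest j).2 u hu
    rw [sum_range_derivative (fun i => δ p n (j + 1) i),
      sum_range_derivative (fun i => δ p n (j + 1) i)] at this
    linarith
  -- the upper bound for an arbitrary ranking
  obtain ⟨e, he, helt⟩ := exists_equiv_card_lt (fun y => π' (.inr y))
    (π'.injective.comp Sum.inr_injective)
  have upper_above : ∀ y, ∑ x ∈ above π' y, sp x ≤
      ∑ i ∈ Finset.range (above π' y).card, k i := fun y => by
    have hinj : Function.Injective fun x : Fin p => (α.symm x : ℕ) :=
      Fin.val_injective.comp α.symm.injective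
    have := sum_le_sum_range_card hkanti
      (T := (above π' y).image fun x : Fin p => (α.symm x : ℕ)) (by simp)
    rw [Finset.card_image_of_injective _ hinj, Finset.sum_image fun _ _ _ _ h => hinj h] at this
    refine le_trans (le_of_eq (Finset.sum_congr rfl fun x _ => ?_)) this
    rw [hk, α.apply_symm_apply]
  -- Rearrangement: the counts above grow with the index `e y` while `v` decreases, so this pairing
  -- is the smallest one. The permutation `ρ.symm.trans e.symm` turns `v ∘ e` into `sn`.
  have upper_mul : ∑ y, ((above π' y).card : ℝ) * v (e y) ≤
      ∑ y, ((above π' y).card : ℝ) * sn y := by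
    have hav : Antivary (fun y => ((above π' y).card : ℝ)) (fun y => v (e y)) := by
      intro y y' h
      have h1 : e y' < e y := by
        by_contra! hle
        exact absurd (hvanti hle) (not_le.2 h)
      have h2 := (helt y' y).1 h1
      exact Nat.cast_le.2 (Finset.card_le_card fun x hx => by
        simp only [above, Finset.mem_filter, Finset.mem_univ, true_and] at hx ⊢
        exact hx.trans h2)
    refine (hav.sum_mul_le_sum_mul_comp_perm (σ := ρ.symm.trans e.symm)).trans
      (le_of_eq (Finset.sum_congr rfl fun y _ => ?_))
    simp [hv]
  have upper : ∑ y, (δ p n ((Finset.univ.filter fun y' => π' (.inr y') < π' (.inr y)).card + 1)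
        ((above π' y).card + 1) + 2 / (p * n) * (∑ x ∈ above π' y, sp x)) -
      2 / (p * n) * ∑ y, ((above π' y).card : ℝ) * sn y ≤
      ∑ j : Fin n, (δ p n (j + 1) (O j + 1) + 2 / (p * n) * (∑ i ∈ Finset.range (O j), k i) -
        2 / (p * n) * (O j * v j)) := by
    refine le_trans ?_ (le_of_eq (e.sum_comp _))
    have h1 := mul_le_mul_of_nonneg_left upper_mul hc
    refine (sub_le_sub_left h1 _).trans ?_
    rw [Finset.mul_sum, ← Finset.sum_sub_distrib]
    refine Finset.sum_le_sum fun y _ => le_trans ?_ (hG (e y) (above π' y).card ?_)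
    · rw [← he y]
      gcongr
      exact upper_above y
    · simpa using Finset.card_le_univ (above π' y)
  -- the value of the given ranking
  have habove : ∀ j, above π (β j) = (Finset.univ.filter fun i : Fin p => (i : ℕ) < O j).map
      α.toEmbedding := fun j => by
    ext x
    simp only [above, Finset.mem_filter, Finset.mem_univ, true_and, Finset.mem_map_equiv]
    rw [← hπ, α.apply_symm_apply]
  have hfil : ∀ j, (Finset.range p).filter (fun i => i < O j) = Finset.range (O j) := fun j => by
    ext i
    have := (hbest j).1
    simp only [Finset.mem_filter, Finset.mem_range]
    omega
  have hcard : ∀ j, (above π (β j)).card = O j := fun j => by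
    rw [habove, Finset.card_map, Finset.card_filter,
      Fin.sum_univ_eq_sum_range (fun i => if i < O j then 1 else 0), ← Finset.card_filter, hfil,
      Finset.card_range]
  have hsum : ∀ j, ∑ x ∈ above π (β j), sp x = ∑ i ∈ Finset.range (O j), k i := fun j => by
    rw [habove, Finset.sum_map, Finset.sum_filter, ← hfil, Finset.sum_filter,
      ← Fin.sum_univ_eq_sum_range (fun i => if i < O j then k i else 0)]
    simp [hk]
  have hind : ∀ j, (Finset.univ.filter fun y' => π (.inr y') < π (.inr (β j))).card = j :=
    fun j => by
    have : (Finset.univ.filter fun y' => π (.inr y') < π (.inr (β j))) =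
        (Finset.Iio j).map β.toEmbedding := by
      ext y
      simp only [Finset.mem_filter, Finset.mem_univ, true_and, Finset.mem_map_equiv,
        Finset.mem_Iio]
      rw [← hπ', β.apply_symm_apply]
    rw [this, Finset.card_map, Fin.card_Iio]
  -- Rearrangement again, now for the constructed ranking: `hO` orders scores only where `O`
  -- differs, and that is all that antivariance requires.
  have lower_mul : ∑ j, (O j : ℝ) * sn (β j) ≤ ∑ j, (O j : ℝ) * v j := by
    have hav : Antivary (fun j => (O j : ℝ)) (fun j => sn (β j)) := by
      intro i j h
      by_contra! hlt
      exact absurd (hO i j (Nat.cast_lt.1 hlt)) (not_le.2 h)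
    refine (hav.sum_mul_le_sum_mul_comp_perm (σ := ρ.trans β.symm)).trans
      (le_of_eq (Finset.sum_congr rfl fun y _ => ?_))
    simp [hv]
  refine upper.trans ?_
  rw [← β.sum_comp (fun y => δ p n _ ((above π y).card + 1) + _), ← β.sum_comp (fun y => ((above π y).card : ℝ) * sn y)]
  simp only [hcard, hsum, hind]
  refine le_trans (le_of_eq ?_) (sub_le_sub_left (mul_le_mul_of_nonneg_left lower_mul hc) _)
  rw [Finset.mul_sum, Finset.sum_sub_distrib]

end Ranking

/-! ### Reading the input and writing the positions -/

namespace RealRAM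

variable {prim : ℕ → ℝ → ℝ → ℝ} {procs : List Cmd}

/-- Copying the scores into the array of keys and initializing the index array. The register `2`
counts the samples. -/
def copyLoops : Cmd :=
  .seq
    (.loop (.nlt (.var 2) (.var 0))
      (.seq (.putReal 2 (.var 2) (.get 0 (.var 2)))
        (.seq (.putNat 1 (.var 2) (.var 2)) (.setNat 2 (.add (.var 2) (.lit 1))))))
    (.loop (.nlt (.var 2) (.add (.var 0) (.var 1)))
      (.seq (.putReal 2 (.var 2) (.get 1 (.sub (.var 2) (.var 0))))
        (.seq (.putNat 1 (.var 2) (.var 2)) (.setNat 2 (.add (.var 2) (.lit 1))))))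

theorem run_copyLoops (s : State) (p n : ℕ) (h0 : s.natVar 0 = p) (h1 : s.natVar 1 = n)
    (h2 : s.natVar 2 = 0) :
    Run prim procs copyLoops s fun t s' =>
      t ≤ 30 * (p + n) + 20 ∧ s'.natVar 0 = p ∧ s'.natVar 1 = n ∧
        (∀ i, i < p + n → s'.natArr 1 i = i) ∧ (∀ i, i < p → s'.realArr 2 i = s.realArr 0 i) ∧
        ∀ i, i < n → s'.realArr 2 (p + i) = s.realArr 1 i := by
  simp only [copyLoops, run_seq]
  refine (run_loop
    (fun u => u.natVar 0 = p ∧ u.natVar 1 = n ∧ u.natVar 2 ≤ p ∧ u.realArr 0 = s.realArr 0 ∧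
      u.realArr 1 = s.realArr 1 ∧ ∀ i, i < u.natVar 2 →
        u.natArr 1 i = i ∧ u.realArr 2 i = s.realArr 0 i)
    (fun u => p - u.natVar 2) 20 ?_ ⟨h0, h1, by omega, rfl, rfl, fun i hi => by omega⟩).mono ?_
  · rintro u ⟨u0, u1, u2, r0, r1, hu⟩ hb
    simp only [BExp.eval, NExp.eval, u0] at hb
    simp [u0, u1, r0, r1]
    refine ⟨by omega, by omega, fun i hi => ?_⟩
    simp only [Function.update_apply]
    split_ifs with h
    · exact ⟨h.symm, by rw [h]⟩
    · exact hu i (by omega)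
  rintro t u ⟨ht, ⟨u0, u1, u2, r0, r1, hu⟩, hb⟩
  simp only [BExp.eval, NExp.eval, u0, not_lt] at hb
  simp [h2] at ht
  refine (run_loop
    (fun w => w.natVar 0 = p ∧ w.natVar 1 = n ∧ p ≤ w.natVar 2 ∧ w.natVar 2 ≤ p + n ∧
      w.realArr 1 = s.realArr 1 ∧ (∀ i, i < p → w.realArr 2 i = s.realArr 0 i) ∧
      (∀ i, i < w.natVar 2 → w.natArr 1 i = i) ∧
      ∀ i, p + i < w.natVar 2 → w.realArr 2 (p + i) = s.realArr 1 i)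
    (fun w => p + n - w.natVar 2) 22 ?_ ⟨u0, u1, hb, by omega, r1,
      fun i hi => (hu i (by omega)).2, fun i hi => (hu i hi).1, fun i hi => by omega⟩).mono ?_
  · rintro w ⟨w0, w1, hp, hn, r1', hw0, hw1, hw2⟩ hlt
    simp only [BExp.eval, NExp.eval, w0, w1] at hlt
    simp [w0, w1, r1']
    refine ⟨by omega, by omega, by omega, fun i hi => ?_, fun i hi => ?_, fun i hi => ?_⟩
    · rw [Function.update_of_ne (by omega)]
      exact hw0 i hi
    · rw [Function.update_apply]
      split_ifs with h
      · exact h.symm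
      · exact hw1 i (by omega)
    · rw [Function.update_apply]
      split_ifs with h
      · rw [show w.natVar 2 - p = i by omega]
      · exact hw2 i (by omega)
  · rintro t' w ⟨ht', ⟨w0, w1, hp, hn, r1', hw0, hw1, hw2⟩, hlt⟩
    simp only [BExp.eval, NExp.eval, w0, w1, not_lt] at hlt
    simp at ht'
    exact ⟨by omega, w0, w1, fun i hi => hw1 i (by omega), hw0, fun i hi => hw2 i (by omega)⟩

/-- Writing the positions of the samples; the registers `2` and `3` count the positive and the
negative samples that have been placed. -/
def mergeLoop : Cmd :=
  .loop (.nlt (.add (.var 2) (.var 3)) (.add (.var 0) (.var 1)))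
    (.cond (.and (.nlt (.var 3) (.var 1))
        (.not (.nlt (.var 2) (.get 2 (.add (.var 0) (.var 3))))))
      (.seq (.putNat 0 (.get 1 (.add (.var 0) (.var 3))) (.add (.var 2) (.var 3)))
        (.setNat 3 (.add (.var 3) (.lit 1))))
      (.seq (.putNat 0 (.get 1 (.var 2)) (.add (.var 2) (.var 3)))
        (.setNat 2 (.add (.var 2) (.lit 1)))))

/-- Placed negative samples have `O` at most the number of placed positive ones, and waiting
negative samples have `O` at least that number. So the `j`-th negative sample is placed exactly when
that number is `O j`, which gives it the position `j + O j`. -/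
theorem run_mergeLoop (s : State) (p n : ℕ) (h0 : s.natVar 0 = p) (h1 : s.natVar 1 = n)
    (h2 : s.natVar 2 = 0) (h3 : s.natVar 3 = 0)
    (hinj : ∀ i j, i < p + n → j < p + n → s.natArr 1 i = s.natArr 1 j → i = j)
    (hO : ∀ j, j < n → s.natArr 2 (p + j) ≤ p)
    (hmono : ∀ i j, i < j → j < n → s.natArr 2 (p + i) ≤ s.natArr 2 (p + j)) :
    Run prim procs mergeLoop s fun t s' =>
      t ≤ 50 * (p + n) + 10 ∧
        (∀ j, j < n → s'.natArr 0 (s.natArr 1 (p + j)) = j + s.natArr 2 (p + j)) ∧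
        ∀ i, i < p → ∃ c, c ≤ n ∧ s'.natArr 0 (s.natArr 1 i) = i + c ∧
          ∀ j, j < n → (j < c ↔ s.natArr 2 (p + j) ≤ i) := by
  refine (run_loop
    (fun u => u.natVar 0 = p ∧ u.natVar 1 = n ∧ u.natVar 2 ≤ p ∧ u.natVar 3 ≤ n ∧
      u.natArr 1 = s.natArr 1 ∧ u.natArr 2 = s.natArr 2 ∧
      (∀ j, j < u.natVar 3 → s.natArr 2 (p + j) ≤ u.natVar 2) ∧
      (∀ j, u.natVar 3 ≤ j → j < n → u.natVar 2 ≤ s.natArr 2 (p + j)) ∧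
      (∀ j, j < u.natVar 3 → u.natArr 0 (s.natArr 1 (p + j)) = j + s.natArr 2 (p + j)) ∧
      ∀ i, i < u.natVar 2 → ∃ c, c ≤ n ∧ u.natArr 0 (s.natArr 1 i) = i + c ∧
        ∀ j, j < n → (j < c ↔ s.natArr 2 (p + j) ≤ i))
    (fun u => p + n - (u.natVar 2 + u.natVar 3)) 40 ?_ ?_).mono ?_
  · rintro u ⟨u0, u1, u2, u3, a1, a2, hle, hge, hneg, hpos⟩ hlt
    simp only [BExp.eval, NExp.eval, u0, u1] at hlt
    refine run_cond (fun hc => ?_) (fun hc => ?_)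
    · simp only [BExp.eval, NExp.eval, u0, u1, a2, not_lt] at hc
      obtain ⟨hc1, hc2⟩ := hc
      have heq : s.natArr 2 (p + u.natVar 3) = u.natVar 2 :=
        le_antisymm hc2 (hge _ le_rfl hc1)
      simp [u0, u1, a1, a2]
      refine ⟨by omega, u2, by omega, fun j hj => ?_, fun j hj1 hj2 => hge j (by omega) hj2,
        fun j hj => ?_, fun i hi => ?_⟩
      · rcases hj.eq_or_lt with rfl | h
        · exact hc2
        · exact hle j (by omega)
      · rcases hj.eq_or_lt with rfl | h
        · rw [Function.update_self, heq, add_comm]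
        · rw [Function.update_of_ne fun h' => by
            have := hinj _ _ (by omega) (by omega) h'
            omega]
          exact hneg j (by omega)
      · rw [Function.update_of_ne fun h' => by
          have := hinj _ _ (by omega) (by omega) h'
          omega]
        exact hpos i hi
    · simp only [BExp.eval, NExp.eval, u0, u1, a2, not_lt, not_and, not_le] at hc
      -- If all positive samples were placed, some negative sample would be waiting with `O > p`.
      have hp : u.natVar 2 < p := by
        by_contra! h
        have h' : u.natVar 3 < n := by omega
        have := hc h'
        have := hO _ h'
        omega
      have hgt : ∀ j, u.natVar 3 ≤ j → j < n → u.natVar 2 < s.natArr 2 (p + j) := fun j hj1 hj2 => by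
        have := hc (by omega)
        rcases hj1.eq_or_lt with rfl | h
        · exact this
        · exact this.trans_le (hmono _ _ h hj2)
      simp [u0, u1, a1, a2]
      refine ⟨by omega, by omega, u3, fun j hj => (hle j hj).trans (Nat.le_succ _),
        fun j hj1 hj2 => hgt j hj1 hj2, fun j hj => ?_, fun i hi => ?_⟩
      · rw [Function.update_of_ne fun h' => by
          have := hinj _ _ (by omega) (by omega) h'
          omega]
        exact hneg j hj
      · rcases hi.eq_or_lt with rfl | h
        -- The number of negative samples above the new positive one is the number placed so far.
        · refine ⟨u.natVar 3, u3, by rw [Function.update_self], fun j hj => ⟨hle j, fun h => ?_⟩⟩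
          by_contra! h'
          have := hgt j h' hj
          omega
        · rw [Function.update_of_ne fun h' => by
            have := hinj _ _ (by omega) (by omega) h'
            omega]
          exact hpos i h
  · refine ⟨h0, h1, by omega, by omega, rfl, rfl, fun j hj => by omega, fun j _ _ => by omega,
      fun j hj => by omega, fun j hj => by omega⟩
  · rintro t u ⟨ht, ⟨u0, u1, u2, u3, a1, a2, hle, hge, hneg, hpos⟩, hlt⟩
    simp only [BExp.eval, NExp.eval, u0, u1, not_lt] at hlt
    simp [h2, h3] at ht
    exact ⟨by omega, fun j hj => hneg j (by omega), fun i hi => hpos i (by omega)⟩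

end RealRAM

/-! ### Assembling the program -/

namespace Ranking

/-- Positions of samples that are given by the numbers `O j` of positive samples above the negative
samples. -/
theorem exists_positions {p n : ℕ} (α : Fin p ≃ Fin p) (β : Fin n ≃ Fin n) (O : Fin n → ℕ)
    (hO : ∀ j, O j ≤ p) (hmono : ∀ i j, i < j → O i ≤ O j) (f : Fin p → ℕ) (g : Fin n → ℕ)
    (hf : ∀ i, ∃ c, c ≤ n ∧ f (α i) = i + c ∧ ∀ j : Fin n, (j : ℕ) < c ↔ O j ≤ i)
    (hg : ∀ j, g (β j) = j + O j) :
    ∃ π : Sample p n ≃ Fin (p + n), (∀ x, (π (.inl x) : ℕ) = f x) ∧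
      (∀ y, (π (.inr y) : ℕ) = g y) ∧
      (∀ i j, π (.inl (α i)) < π (.inr (β j)) ↔ (i : ℕ) < O j) ∧
      ∀ i j, π (.inr (β i)) < π (.inr (β j)) ↔ i < j := by
  have hff : ∀ i i', i < i' → f (α i) < f (α i') := fun i i' h => by
    obtain ⟨c, hc, hfc, hcO⟩ := hf i
    obtain ⟨c', hc', hfc', hcO'⟩ := hf i'
    have : c ≤ c' := by
      by_contra! hlt
      have h1 := (hcO ⟨c', by omega⟩).1 hlt
      have h2 := (hcO' ⟨c', by omega⟩).2 (h1.trans h.le)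
      exact lt_irrefl _ h2
    have := Fin.lt_def.1 h
    omega
  have hgg : ∀ j j', j < j' → g (β j) < g (β j') := fun j j' h => by
    have := hmono j j' h
    have := Fin.lt_def.1 h
    rw [hg, hg]
    omega
  have hfg : ∀ i j, (f (α i) < g (β j) ↔ (i : ℕ) < O j) ∧ f (α i) ≠ g (β j) := fun i j => by
    obtain ⟨c, hc, hfc, hcO⟩ := hf i
    have := hcO j
    rw [hg, hfc]
    omega
  have hfb : ∀ x, f x < p + n := fun x => by
    obtain ⟨c, hc, hfc, -⟩ := hf (α.symm x)
    rw [α.apply_symm_apply] at hfc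
    have := (α.symm x).isLt
    omega
  have hgb : ∀ y, g y < p + n := fun y => by
    have h1 := hg (β.symm y)
    rw [β.apply_symm_apply] at h1
    have := (β.symm y).isLt
    have := hO (β.symm y)
    omega
  let P : Sample p n → Fin (p + n) := Sum.elim (fun x => ⟨f x, hfb x⟩) (fun y => ⟨g y, hgb y⟩)
  have hP : Function.Injective P := by
    have hfi : ∀ x x', f x = f x' → x = x' := fun x x' h => by
      obtain ⟨i, rfl⟩ := α.surjective x
      obtain ⟨i', rfl⟩ := α.surjective x'
      rcases lt_trichotomy i i' with h' | h' | h'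
      · exact absurd h (hff _ _ h').ne
      · rw [h']
      · exact absurd h (hff _ _ h').ne'
    have hgi : ∀ x x', g x = g x' → x = x' := fun x x' h => by
      obtain ⟨i, rfl⟩ := β.surjective x
      obtain ⟨i', rfl⟩ := β.surjective x'
      rcases lt_trichotomy i i' with h' | h' | h'
      · exact absurd h (hgg _ _ h').ne
      · rw [h']
      · exact absurd h (hgg _ _ h').ne'
    have hne : ∀ x y, f x ≠ g y := fun x y => by
      obtain ⟨i, rfl⟩ := α.surjective x
      obtain ⟨j, rfl⟩ := β.surjective y
      exact (hfg i j).2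
    rintro (x | y) (x' | y') h
    · rw [hfi x x' (Fin.mk.inj_iff.1 h)]
    · exact absurd (Fin.mk.inj_iff.1 h) (hne x y')
    · exact absurd (Fin.mk.inj_iff.1 h).symm (hne x' y)
    · rw [hgi y y' (Fin.mk.inj_iff.1 h)]
  have hbij : Function.Bijective P :=
    (Fintype.bijective_iff_injective_and_card P).2 ⟨hP, by simp⟩
  refine ⟨Equiv.ofBijective P hbij, fun x => rfl, fun y => rfl, fun i j => (hfg i j).1,
    fun i j => ⟨fun h => ?_, fun h => hgg i j h⟩⟩
  rcases lt_trichotomy i j with h' | rfl | h'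
  · exact h'
  · exact absurd h (lt_irrefl _)
  · exact absurd (hgg j i h') (not_lt.2 (le_of_lt (Fin.lt_def.1 h)))

theorem exists_equiv_of_perm {l n : ℕ} (θ : Equiv.Perm ℕ)
    (h : ∀ j, j < n → l ≤ θ (l + j) ∧ θ (l + j) < l + n) :
    ∃ e : Fin n ≃ Fin n, ∀ j : Fin n, θ (l + j) = l + e j := by
  let g : Fin n → Fin n := fun j => ⟨θ (l + j) - l, by have := h j j.isLt; omega⟩
  have hg : ∀ j : Fin n, θ (l + j) = l + g j := fun j => by
    have := h j j.isLt
    change _ = l + (θ (l + j) - l)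
    omega
  have hinj : Function.Injective g := fun j j' hj => by
    have := θ.injective ((hg j).trans (hj ▸ (hg j').symm))
    exact Fin.ext (by omega)
  exact ⟨Equiv.ofBijective g (Finite.injective_iff_bijective.1 hinj), hg⟩

/-- The procedures of the program for loss-augmented inference; those of the given program come
first. -/
def procedures (D : RealRAM.Program) : List RealRAM.Cmd :=
  D.procs ++ [D.main, RealRAM.exchangeSort, RealRAM.select D.procs.length,
    RealRAM.quickSort D.procs.length, RealRAM.interleave D.procs.length]

open RealRAM in
/-- The main command of the program for loss-augmented inference. -/
def inference (B : ℕ) : Cmd :=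
  .seq copyLoops
    (.seq (.call (B + 3) [.lit 0, .var 0] [] 8 0)
      (.seq (.call (B + 4) [.var 0, .add (.var 0) (.var 1), .lit 0, .var 0, .var 0, .var 1] [] 8 0)
        (.seq (.setNat 2 (.lit 0)) (.seq (.setNat 3 (.lit 0)) mergeLoop))))

theorem derivative_mono {δ : ℕ → ℕ → ℕ → ℕ → ℝ} (hδ : MonotoneDerivative δ) {p n i j u : ℕ}
    (hp : 1 ≤ p) (hn : 1 ≤ n) (hi : 1 ≤ i) (hij : i ≤ j) (hj : j ≤ n) (hu : 1 ≤ u) (hu' : u ≤ p) :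
    δ p n i (u + 1) - δ p n i u ≤ δ p n j (u + 1) - δ p n j u := by
  induction j, hij using Nat.le_induction with
  | base => exact le_rfl
  | succ j hij ih =>
    exact (ih (by omega)).trans (hδ p n hp hn j u (by omega) (by omega) hu hu')

theorem exists_isBest (p : ℕ) (d : ℕ → ℝ) : ∃ u, 0 ≤ u ∧ u ≤ p ∧ RealRAM.IsBest p d u := by
  obtain ⟨u, hu, hmax⟩ := Finset.exists_max_image (Finset.range (p + 1))
    (fun u => ∑ i ∈ Finset.range u, d i) ⟨0, by simp⟩
  rw [Finset.mem_range] at hu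
  exact ⟨u, Nat.zero_le _, by omega, by omega, fun v hv =>
    hmax v (Finset.mem_range.2 (by omega))⟩

open RealRAM in
theorem run_inference {prim : ℕ → ℝ → ℝ → ℝ} {Δ : Loss} {δ : ℕ → ℕ → ℕ → ℕ → ℝ} {D : Program}
    {κ p n : ℕ} (hΔ : NegDecomposable Δ δ) (hδ : MonotoneDerivative δ) (hp : 1 ≤ p) (hn : 1 ≤ n)
    (hD : DerivativeSpec prim (procedures D) D.main κ p n (δ p n)) (sp : Fin p → ℝ)
    (sn : Fin n → ℝ) :
    Run prim (procedures D) (inference D.procs.length) (inputState sp sn) fun t s' =>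
      (t : ℝ) ≤ 80 * (p + n) + 100 + 50100 * (p + 1) * (Nat.log 2 p + 1) +
        (κ + 60000) * interleaveBound n p ∧
      ∃ π : Sample p n ≃ Fin (p + n), Outputs s' π ∧ IsOptimal Δ sp sn (ofPositions π) := by
  have hB : (procedures D)[D.procs.length]? = some D.main := by simp [procedures]
  have hB1 : (procedures D)[D.procs.length + 1]? = some exchangeSort := by simp [procedures]
  have hB2 : (procedures D)[D.procs.length + 2]? = some (select D.procs.length) := by
    simp [procedures]
  have hB3 : (procedures D)[D.procs.length + 3]? = some (quickSort D.procs.length) := by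
    simp [procedures]
  have hB4 : (procedures D)[D.procs.length + 4]? = some (interleave D.procs.length) := by
    simp [procedures]
  simp only [inference, run_seq, run_setNat]
  refine (run_copyLoops _ p n (by simp [inputState]) (by simp [inputState])
    (by simp [inputState])).mono ?_
  rintro t1 s1 ⟨ht1, p1, n1, idx1, kp1, kn1⟩
  refine run_call hB3 ((run_quickSort hB1 hB2 hB3 _ 0 p (by simp) (by simp [p1])).mono ?_)
  rintro t2 s2 ⟨ht2, loc2, sort2⟩
  replace loc2 : Local 0 p s1 s2 := (Local.of_eq rfl rfl).trans loc2
  -- the sorted order of the negative samples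
  obtain ⟨-, s₀, -, -, loc0, sort0⟩ := run_exchangeSort (prim := prim) (procs := [])
    (s2.enter [p, p + n] []) p (p + n) (by simp) (by simp)
  -- `s₀` is a reference state for the proof only: the program never runs this sort, so its cost
  -- does not count.
  replace loc0 : Local p (p + n) s2 s₀ := (Local.of_eq rfl rfl).trans loc0
  let d : ℕ → ℕ → ℝ := fun j u => δ p n (j - p + 1) (u + 2) - δ p n (j - p + 1) (u + 1) +
    2 / (p * n) * (s₀.key u - s₀.key j)
  have hdmono : ∀ i j u, p ≤ i → i ≤ j → j < p + n → u < p → d i u ≤ d j u := by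
    intro i j u hi hij hj hu
    have h1 := derivative_mono hδ hp hn (i := i - p + 1) (j := j - p + 1) (u := u + 1) (by omega)
      (by omega) (by omega) (by omega) (by omega)
    have h2 := sort0 i j hi hij hj
    simp only [d]
    gcongr
  refine run_call hB4 ((run_interleave hB hD hB1 hB2 hB4 d s₀ (fun j u _ _ _ => rfl) hdmono sort0 _
    p (p + n) 0 p ?_ ?_ ?_ ?_ ?_ ?_ le_rfl (by omega) le_rfl (by omega) le_rfl ?_
    (fun j _ _ => exists_isBest p (d j))).mono ?_)
  · simp [p1]
  · simp [p1, n1]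
  · simp
  · simp [p1]
  · simp [p1]
  · simp [n1]
  -- At the ends of the whole block of negative samples, separation is vacuous.
  · exact ⟨fun i hi => (loc0.key_outside (by omega)).symm, fun P => (loc0.count_eq P).symm,
      fun i j _ _ _ _ => by omega, fun i j _ _ _ _ => by omega⟩
  rintro t3 s3 ⟨ht3, loc3, post⟩
  replace loc3 : Local p (p + n) s2 s3 := (Local.of_eq rfl rfl).trans loc3
  obtain ⟨real2, -, σ, hσ, idx2⟩ := loc2
  obtain ⟨real3, -, τ, hτ, idx3⟩ := loc3
  obtain ⟨real0, -, ω, hω, idx0⟩ := loc0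
  have memσ : ∀ i, i < p → σ i < p := fun i hi => ((perm_mem_segment hσ).2 ⟨by omega, hi⟩).2
  have memτ : ∀ j, j < n → p ≤ τ (p + j) ∧ τ (p + j) < p + n := fun j hj =>
    (perm_mem_segment hτ).2 (by omega)
  have memω : ∀ j, j < n → p ≤ ω (p + j) ∧ ω (p + j) < p + n := fun j hj =>
    (perm_mem_segment hω).2 (by omega)
  obtain ⟨α, hα⟩ := exists_equiv_of_perm (l := 0) (n := p) σ fun j hj => by
    rw [zero_add]; exact ⟨Nat.zero_le _, by have := memσ j hj; omega⟩
  obtain ⟨β, hβ⟩ := exists_equiv_of_perm τ memτ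
  obtain ⟨ρ, hρ⟩ := exists_equiv_of_perm ω memω
  simp only [zero_add] at hα
  have idx2n : ∀ x, p ≤ x → x < p + n → s2.natArr 1 x = x := fun x hx hx' => by
    rw [idx2, Function.comp, hσ x (by omega), idx1 x hx']
  have idx2p : ∀ i : Fin p, s2.natArr 1 i = α i := fun i => by
    rw [idx2, Function.comp, idx1 _ (by have := memσ i i.isLt; omega), hα]
  have idx3n : ∀ j : Fin n, s3.natArr 1 (p + j) = p + β j := fun j => by
    rw [idx3, Function.comp, idx2n _ (memτ j j.isLt).1 (memτ j j.isLt).2, hβ]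
  have idx3p : ∀ i : Fin p, s3.natArr 1 i = α i := fun i => by
    rw [idx3, Function.comp, hτ i (by omega), idx2p]
  have keyp : ∀ i : Fin p, s₀.key i = sp (α i) := fun i => by
    rw [State.key, real0, real2, idx0, Function.comp, hω i (by omega), idx2p, kp1 _ (α i).isLt]
    simp [inputState]
  have keyv : ∀ j : Fin n, s₀.key (p + j) = sn (ρ j) := fun j => by
    rw [State.key, real0, real2, idx0, Function.comp, idx2n _ (memω j j.isLt).1 (memω j j.isLt).2,
      hρ, kn1 _ (ρ j).isLt]
    simp [inputState]
  have keyn : ∀ j : Fin n, s3.key (p + j) = sn (β j) := fun j => by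
    rw [State.key, real3, real2, idx3n, kn1 _ (β j).isLt]
    simp [inputState]
  have hinj : ∀ i j, i < p + n → j < p + n → s3.natArr 1 i = s3.natArr 1 j → i = j := by
    have h : ∀ i, i < p + n → s3.natArr 1 i = σ (τ i) := fun i hi => by
      rw [idx3, idx2, Function.comp, Function.comp, idx1]
      rcases lt_or_ge i p with h | h
      · rw [hτ i (by omega)]
        have := memσ i h
        omega
      · have := memτ (i - p) (by omega)
        rw [show p + (i - p) = i by omega] at this
        rw [hσ _ (by omega)]
        omega
    intro i j hi hj hij
    rw [h i hi, h j hj] at hij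
    exact τ.injective (σ.injective hij)
  have hOle : ∀ j, j < n → s3.natArr 2 (p + j) ≤ p := fun j hj =>
    (post.mem (p + j) (by omega) (by omega)).2.1
  have hOmono : ∀ i j, i < j → j < n → s3.natArr 2 (p + i) ≤ s3.natArr 2 (p + j) := fun i j hij hj =>
    (post.mono (p + i) (p + j) (by omega) (by omega) (by omega)).1
  refine (run_mergeLoop _ p n ?_ ?_ ?_ ?_ ?_ ?_ ?_).mono ?_
  · simp [p1]
  · simp [n1]
  · simp
  · simp
  · exact hinj
  · exact hOle
  · exact hOmono
  rintro t4 s4 ⟨ht4, outn, outp⟩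
  change ∀ j, j < n → s4.natArr 0 (s3.natArr 1 (p + j)) = j + s3.natArr 2 (p + j) at outn
  change ∀ i, i < p → ∃ c, c ≤ n ∧ s4.natArr 0 (s3.natArr 1 i) = i + c ∧
    ∀ j, j < n → (j < c ↔ s3.natArr 2 (p + j) ≤ i) at outp
  obtain ⟨π, hπp, hπn, hlt, hltn⟩ := exists_positions α β (fun j => s3.natArr 2 (p + j))
    (fun j => hOle j j.isLt) (fun i j hij => hOmono i j hij j.isLt) (fun x => s4.natArr 0 x)
    (fun y => s4.natArr 0 (p + y))
    (fun i => by
      obtain ⟨c, hc, h1, h2⟩ := outp i i.isLt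
      exact ⟨c, hc, by rw [← h1, idx3p], fun j => h2 j j.isLt⟩)
    (fun j => by rw [← outn j j.isLt, idx3n])
  refine ⟨?_, π, ⟨fun x => (hπp x).symm, fun y => (hπn y).symm⟩, ?_⟩
  · have ht1' : (t1 : ℝ) ≤ 30 * (p + n) + 20 := by exact_mod_cast ht1
    have ht2' : (t2 : ℝ) ≤ 50100 * (p + 1) * (Nat.log 2 p + 1) := by
      rw [Nat.sub_zero] at ht2
      exact_mod_cast ht2
    have ht4' : (t4 : ℝ) ≤ 50 * (p + n) + 10 := by exact_mod_cast ht4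
    rw [Nat.add_sub_cancel_left, Nat.sub_zero] at ht3
    simp
    linarith
  · refine isOptimal_of_isBest hΔ hp hn sp sn (fun i => s₀.key i) α β ρ (fun j => s₀.key (p + j))
      (fun j => s3.natArr 2 (p + j)) π keyp ?_ keyv ?_ ?_ ?_ hlt hltn
    · intro i j hij hj
      have e : ∀ i, i < p → s₀.key i = s2.key i := fun i hi => by
        rw [State.key, State.key, real0, idx0, Function.comp, hω i (by omega)]
      rw [e i (by omega), e j hj]
      exact sort2 i j (by omega) hij hj
    · exact fun i j hij => sort0 (p + i) (p + j) (by omega) (by have := Fin.le_def.1 hij; omega)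
        (by omega)
    · intro i j hij
      rw [← keyn, ← keyn]
      rcases lt_trichotomy i j with h | rfl | h
      · exact (post.mono (p + i) (p + j) (by omega) (by have := Fin.lt_def.1 h; omega)
          (by omega)).2 hij
      · exact absurd hij (lt_irrefl _)
      · exact absurd (hOmono j i h i.isLt) (not_le.2 hij)
    · intro j
      have := (post.mem (p + j) (by omega) (by omega)).2.2
      simpa only [d, Nat.add_sub_cancel_left] using this

theorem derivativeSpec_procedures {prim : ℕ → ℝ → ℝ → ℝ} {δ : ℕ → ℕ → ℕ → ℕ → ℝ}
    {D : RealRAM.Program} {κ : ℕ} {p n : ℕ}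
    (h : ∀ j i : ℕ, 1 ≤ j → j ≤ n → 1 ≤ i → i ≤ p → ∀ s : RealRAM.State,
      ∃ (t : ℕ) (s' : RealRAM.State), D.Runs prim (s.enter [p, n, j, i] []) t s' ∧ t ≤ κ ∧
        s'.realVar 0 = δ p n j (i + 1) - δ p n j i ∧
        s'.natArr = s.natArr ∧ s'.realArr = s.realArr) :
    RealRAM.DerivativeSpec prim (procedures D) D.main κ p n (δ p n) := by
  intro j i hj hj' hi hi' s
  obtain ⟨t, s', he, hrest⟩ := h j i hj hj' hi hi' s
  exact ⟨t, s', he.append _, hrest⟩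

/-! ### Estimates for the running time -/

/-- The order of the running time. -/
noncomputable def timeOrder (p n : ℕ) : ℝ :=
  n * Real.log (1 + p) + p * Real.log (1 + p) + p * Real.log (1 + n)

/-- Since `log 2 > 1/2`, the logarithm of `1 + p` absorbs constants even for `p = 1`. -/
theorem one_le_two_mul_log {p : ℕ} (hp : 1 ≤ p) : 1 ≤ 2 * Real.log (1 + p) := by
  have h1 : Real.log 2 ≤ Real.log (1 + p) := by
    have : (1 : ℝ) ≤ p := by exact_mod_cast hp
    exact Real.log_le_log two_pos (by linarith)
  have := Real.log_two_gt_d9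
  linarith

theorem logb_two_le {x : ℝ} (hx : 1 ≤ x) : Real.logb 2 x ≤ 2 * Real.log x := by
  have h0 := Real.log_nonneg hx
  have h2 := Real.log_two_gt_d9
  rw [Real.logb, div_le_iff₀ (by linarith)]
  nlinarith

theorem natLog_le {p : ℕ} (hp : 1 ≤ p) : (Nat.log 2 p : ℝ) ≤ 2 * Real.log (1 + p) := by
  have h1 : (1 : ℝ) ≤ p := by exact_mod_cast hp
  refine (Real.natLog_le_logb p 2).trans ((logb_two_le h1).trans ?_)
  have := Real.log_le_log (by linarith : (0 : ℝ) < p) (by linarith : (p : ℝ) ≤ 1 + p)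
  linarith

theorem size_le {n : ℕ} (hn : 1 ≤ n) : (n.size : ℝ) ≤ 4 * Real.log (1 + n) := by
  have h : n.size ≤ Nat.log 2 n + 1 := Nat.size_le.2 (Nat.lt_pow_succ_log_self one_lt_two n)
  have h1 : (n.size : ℝ) ≤ Nat.log 2 n + 1 := by exact_mod_cast h
  have := natLog_le hn
  have := one_le_two_mul_log hn
  linarith

theorem time_le {p n : ℕ} (hp : 1 ≤ p) (hn : 1 ≤ n) (κ : ℕ) :
    80 * (p + n) + 100 + 50100 * (p + 1) * (Nat.log 2 p + 1) +
      (κ + 60000) * RealRAM.interleaveBound n p ≤ (12 * κ + 2000000) * timeOrder p n := by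
  have hp' : (1 : ℝ) ≤ p := by exact_mod_cast hp
  have hn' : (1 : ℝ) ≤ n := by exact_mod_cast hn
  have lp := one_le_two_mul_log hp
  have ln := one_le_two_mul_log hn
  have e1 : (n : ℝ) ≤ 2 * (n * Real.log (1 + p)) := by nlinarith
  have e2 : (p : ℝ) ≤ 2 * (p * Real.log (1 + p)) := by nlinarith
  have e3 : 0 ≤ (p : ℝ) * Real.log (1 + n) := mul_nonneg (by linarith) (by linarith)
  have e4 : ((p : ℝ) + 1) * (Nat.log 2 p + 1) ≤ 8 * (p * Real.log (1 + p)) := by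
    have h1 : (Nat.log 2 p : ℝ) + 1 ≤ 4 * Real.log (1 + p) := by
      have := natLog_le hp
      linarith
    have h2 : (p : ℝ) + 1 ≤ 2 * p := by linarith
    calc ((p : ℝ) + 1) * (Nat.log 2 p + 1) ≤ (2 * p) * (4 * Real.log (1 + p)) :=
          mul_le_mul h2 h1 (by positivity) (by linarith)
      _ = _ := by ring
  have e5 : RealRAM.interleaveBound n p ≤ 12 * timeOrder p n := by
    unfold RealRAM.interleaveBound timeOrder
    have h1 : Real.logb 2 (p + 1) ≤ 2 * Real.log (1 + p) := by
      rw [add_comm]; exact logb_two_le (by linarith)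
    have h2 := mul_le_mul_of_nonneg_left h1 (by linarith : (0 : ℝ) ≤ n)
    have h3 := mul_le_mul_of_nonneg_left (size_le hn) (by linarith : (0 : ℝ) ≤ p)
    linarith
  have e6 := mul_le_mul_of_nonneg_left e5 (by positivity : (0 : ℝ) ≤ κ + 60000)
  unfold timeOrder at *
  linarith

/-- Bernoulli's inequality `1 + n ≤ (1 + p)^(n/p)` for `n ≥ p` gives `p log(1 + n) ≤ n log(1 + p)`;
the other two terms are immediate. -/
theorem timeOrder_le_of_lt {p n : ℕ} (hp : 1 ≤ p) (hpn : p < n) :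
    timeOrder p n ≤ 3 * (n * Real.log (1 + p)) := by
  have hp' : (1 : ℝ) ≤ p := by exact_mod_cast hp
  have hpn' : (p : ℝ) ≤ n := by exact_mod_cast hpn.le
  have lp := one_le_two_mul_log hp
  have h1 : (p : ℝ) * Real.log (1 + p) ≤ n * Real.log (1 + p) := by
    gcongr
    linarith
  have h2 : (p : ℝ) * Real.log (1 + n) ≤ n * Real.log (1 + p) := by
    have hr : (1 : ℝ) ≤ n / p := (one_le_div (by linarith)).2 hpn'
    have hb := one_add_mul_self_le_rpow_one_add (s := (p : ℝ)) (by linarith) hr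
    rw [div_mul_cancel₀ _ (by linarith : (p : ℝ) ≠ 0)] at hb
    have hl := Real.log_le_log (by positivity) hb
    rw [Real.log_rpow (by positivity), div_mul_eq_mul_div, le_div_iff₀ (by linarith)] at hl
    linarith
  unfold timeOrder
  linarith

theorem log_one_add_le_two_mul_log {p : ℕ} (hp : 2 ≤ p) :
    Real.log (1 + p) ≤ 2 * Real.log p := by
  have hp' : (2 : ℝ) ≤ p := by exact_mod_cast hp
  have : Real.log (1 + p) ≤ Real.log ((p : ℝ) ^ 2) :=
    Real.log_le_log (by positivity) (by nlinarith)
  rw [Real.log_pow] at this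
  exact_mod_cast this

/-- For `p ≥ 2` one has `1 + p ≤ p²` and `1 + n ≤ p n`. The extra `p log p` from the second is
absorbed by the term already present. -/
theorem timeOrder_le_of_two_le {p n : ℕ} (hp : 2 ≤ p) (hn : 1 ≤ n) :
    timeOrder p n ≤ 3 * (n * Real.log p + p * Real.log p + p * Real.log n) := by
  have hp' : (2 : ℝ) ≤ p := by exact_mod_cast hp
  have hn' : (1 : ℝ) ≤ n := by exact_mod_cast hn
  have lp := log_one_add_le_two_mul_log hp
  have l0 : 0 ≤ Real.log p := Real.log_nonneg (by linarith)
  have l0' : 0 ≤ Real.log n := Real.log_nonneg hn'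
  have ln : Real.log (1 + n) ≤ Real.log p + Real.log n := by
    rw [← Real.log_mul (by positivity) (by positivity)]
    exact Real.log_le_log (by positivity) (by nlinarith)
  have h1 := mul_le_mul_of_nonneg_left lp (by linarith : (0 : ℝ) ≤ n)
  have h2 := mul_le_mul_of_nonneg_left lp (by linarith : (0 : ℝ) ≤ p)
  have h3 := mul_le_mul_of_nonneg_left ln (by linarith : (0 : ℝ) ≤ p)
  have h4 : 0 ≤ (n : ℝ) * Real.log p := by positivity
  have h5 : 0 ≤ (p : ℝ) * Real.log n := by positivity
  unfold timeOrder
  linarith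

end Ranking

theorem mainTheorem1 (prim : ℕ → ℝ → ℝ → ℝ) (Δ : Ranking.Loss)
    (hΔ : Ranking.QSSuitable prim Δ) :
    ∃ (A : RealRAM.Program) (T : ℕ → ℕ → ℝ) (C : ℝ),
      Ranking.SolvesWithin prim Δ A T ∧
      (∀ p n : ℕ, 1 ≤ p → 1 ≤ n →
        T p n ≤ C * (n * Real.log (1 + p) + p * Real.log (1 + p) + p * Real.log (1 + n))) ∧
      (∀ p n : ℕ, 1 ≤ p → p < n → T p n ≤ C * (n * Real.log (1 + p))) ∧
      (∀ p n : ℕ, 2 ≤ p → 1 ≤ n →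
        T p n ≤ C * (n * Real.log p + p * Real.log p + p * Real.log n)) ∧
      (∀ p n : ℕ, 2 ≤ p → p < n → T p n ≤ C * (n * Real.log p)) := by
  obtain ⟨δ, hdec, hmono, D, κ, hD⟩ := hΔ
  have hK : (0 : ℝ) ≤ 12 * κ + 2000000 := by positivity
  -- The factor `6` covers all four bounds: `3` from merging the three terms when `p < n`, and `2`
  -- from replacing `log (1 + p)` by `log p`.
  refine ⟨⟨Ranking.procedures D, Ranking.inference D.procs.length⟩,
    fun p n => (12 * κ + 2000000) * Ranking.timeOrder p n, 6 * (12 * κ + 2000000), ?_, ?_, ?_, ?_,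
    ?_⟩
  · intro p n hp hn sp sn
    obtain ⟨t, s', he, ht, π, hout, hopt⟩ := Ranking.run_inference hdec hmono hp hn
      (Ranking.derivativeSpec_procedures (hD p n hp hn)) sp sn
    exact ⟨t, s', π, he, ht.trans (Ranking.time_le hp hn κ), hout, hopt⟩
  · intro p n hp hn
    have h0 : 0 ≤ Ranking.timeOrder p n := by
      have := Ranking.one_le_two_mul_log hp
      have := Ranking.one_le_two_mul_log hn
      have h1 : 0 ≤ Real.log (1 + p) := by linarith
      have h2 : 0 ≤ Real.log (1 + n) := by linarith
      unfold Ranking.timeOrder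
      positivity
    change _ ≤ _ * Ranking.timeOrder p n
    nlinarith [mul_nonneg hK h0]
  · intro p n hp hpn
    have h := mul_le_mul_of_nonneg_left (Ranking.timeOrder_le_of_lt hp hpn) hK
    have h0 : 0 ≤ (n : ℝ) * Real.log (1 + p) := by
      have := Ranking.one_le_two_mul_log hp
      exact mul_nonneg (Nat.cast_nonneg n) (by linarith)
    dsimp only
    linarith [mul_nonneg hK h0]
  · intro p n hp hn
    have h := mul_le_mul_of_nonneg_left (Ranking.timeOrder_le_of_two_le hp hn) hK
    have h0 : 0 ≤ (n : ℝ) * Real.log p + p * Real.log p + p * Real.log n := by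
      have : 0 ≤ Real.log p := Real.log_natCast_nonneg p
      have : 0 ≤ Real.log n := Real.log_natCast_nonneg n
      positivity
    dsimp only
    linarith [mul_nonneg hK h0]
  · intro p n hp hpn
    have h := mul_le_mul_of_nonneg_left (Ranking.timeOrder_le_of_lt (by omega) hpn) hK
    have h1 := mul_le_mul_of_nonneg_left (Ranking.log_one_add_le_two_mul_log hp)
      (Nat.cast_nonneg (α := ℝ) n)
    have h2 := mul_le_mul_of_nonneg_left h1 hK
    dsimp only
    linarith
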